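/- A \emph{simple drawing} of $K_n$ maps the vertices to distinct points of the plane and the edges to simple curves joining their endpoints and passing through no other vertex, such that any two different edges have at most one point in common, which is either a common endpoint or a proper crossing. For $n\ge 6$, let $\mathcal T'_n$ denote the simple drawing of $K_n$ with vertices $1,\dots,n$, determined up to isomorphism (relabelling of vertices preserving the pairs of crossing edges), whose pairs of crossing edges are exactly the following: \begin{itemize} \item $\{i,\ell\}$ and $\{j,k\}$ for $i<j<k<\ell$ in $\{1,\dots,n\}\setminus\{2\}$ (so the vertices other than $2$ induce a twisted drawing); \item $\{1,2\}$ with $\{3,n\}$, with $\{3,4\}$, and with $\{4,i\}$ for $5\le i\le n$; \item $\{2,4\}$ with $\{3,n\}$; \item for each $5\le j\le n-1$, $\{2,j\}$ with $\{1,3\}$, with $\{3,n\}$, with $\{1,k\}$ for $j<k\le n$, and with $\{i,k\}$ for $2<i<k<j$; \item $\{2,n\}$ with $\{i,j\}$ for $3<i<j\le n-1$. \end{itemize} (In particular $\{2,3\}$ is crossed by no edge.) A cycle of length $k\ge 3$ in a simple drawing is \emph{plane} if no two of its edges cross. A \emph{side} of a plane cycle (in particular of a triangle, $k=3$) is the closure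 of a connected component of the complement of the curve formed by its edges; a side is \emph{empty} if it has no vertex in its interior. An \emph{empty $4$-triangulation} is a plane cycle of length $4$ having an empty side that is a union of empty sides of triangles of the drawing with pairwise disjoint interiors. A \emph{$4$-hole} is a set of four vertices $v_1,v_2,v_3,v_4$ for which $\{v_1,v_3\}$ crosses $\{v_2,v_4\}$, this being the only crossing among their edges, and such that no vertex of the drawing lies in the interior of their convex side. Here the convex side is the union of those sides $S$ of the triangles spanned by three of the four vertices such that every edge joining two of the four vertices lying in $S$ is contained in $S$. \textbf{Proposition.} For every $n\ge 6$ the simple drawing $\mathcal T'_n$ exists, that is, there is a simple drawing of $K_n$ with exactly these pairs of crossing edges. Every such drawing is crossing maximal (every four vertices induce a crossing), and it contains no empty $4$-triangulation. In particular, it contains no $4$-hole. -/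

import Mathlib

/-! Simple drawings of complete graphs in the plane (modelled by the topological space `ℂ`). -/

/-- `A` is a simple curve with endpoints `p` and `q`. -/
def IsSimpleArc (A : Set ℂ) (p q : ℂ) : Prop :=
  ∃ γ : unitInterval → ℂ, Continuous γ ∧ Function.Injective γ ∧
    γ 0 = p ∧ γ 1 = q ∧ Set.range γ = A

/-- The curves `A` and `B` cross properly at `p`: near `p` the pair `(A, B)` looks, after a local
homeomorphism of the plane, like the two coordinate axes near the origin. -/
def IsProperCrossing (A B : Set ℂ) (p : ℂ) : Prop :=
  ∃ φ : OpenPartialHomeomorph ℂ ℂ, p ∈ φ.source ∧ φ p = 0 ∧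
    ∀ x ∈ φ.source, (x ∈ A ↔ (φ x).im = 0) ∧ (x ∈ B ↔ (φ x).re = 0)

/-- A simple drawing in the plane of the complete graph with vertex set `V`.
The edges are the non-diagonal elements of `Sym2 V`; the value of `edge` on a diagonal element
is irrelevant and is never used. -/
structure SimpleDrawing (V : Type*) where
  /-- the point representing a vertex -/
  pt : V → ℂ
  /-- the curve (as a set of points) representing an edge -/
  edge : Sym2 V → Set ℂ
  pt_injective : Function.Injective pt
  edge_arc : ∀ u v : V, u ≠ v → IsSimpleArc (edge s(u, v)) (pt u) (pt v)
  /-- an edge passes through no vertices other than its endpoints -/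
  edge_vertex : ∀ e : Sym2 V, ¬ e.IsDiag → ∀ w : V, pt w ∈ edge e → w ∈ e
  /-- two different edges have at most one point in common -/
  edge_inter : ∀ e f : Sym2 V, ¬ e.IsDiag → ¬ f.IsDiag → e ≠ f →
    (edge e ∩ edge f).Subsingleton
  /-- a common point of two edges is a common vertex or a proper crossing -/
  edge_common : ∀ e f : Sym2 V, ¬ e.IsDiag → ¬ f.IsDiag → e ≠ f → ∀ p ∈ edge e ∩ edge f,
    (∃ v : V, v ∈ e ∧ v ∈ f ∧ pt v = p) ∨ IsProperCrossing (edge e) (edge f) p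

/-- `S` is a side of the closed curve `J`: the closure of a connected component of the
complement of `J`. -/
def IsSide (J S : Set ℂ) : Prop :=
  ∃ x ∈ Jᶜ, S = closure (connectedComponentIn Jᶜ x)

namespace SimpleDrawing

variable {V : Type*} (D : SimpleDrawing V)

/-- Two different edges cross: they have a common point that is not a vertex. -/
def Crosses (e f : Sym2 V) : Prop :=
  e ≠ f ∧ ∃ p ∈ D.edge e ∩ D.edge f, p ∉ Set.range D.pt

/-- Every four vertices induce a crossing. -/
def CrossingMaximal : Prop :=
  ∀ a b c d : V, [a, b, c, d].Nodup →
    D.Crosses s(a, b) s(c, d) ∨ D.Crosses s(a, c) s(b, d) ∨ D.Crosses s(a, d) s(b, c)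

/-- A region is empty if no vertex lies in its interior. -/
def IsEmptyRegion (S : Set ℂ) : Prop :=
  ∀ w : V, D.pt w ∉ interior S

/-- The closed curve formed by the three edges on the vertices `a, b, c`. -/
def triangle (a b c : V) : Set ℂ :=
  D.edge s(a, b) ∪ D.edge s(b, c) ∪ D.edge s(a, c)

/-- `S` is an empty side of some triangle of the drawing. -/
def IsEmptyTriangle (S : Set ℂ) : Prop :=
  ∃ a b c : V, a ≠ b ∧ b ≠ c ∧ a ≠ c ∧ IsSide (D.triangle a b c) S ∧ D.IsEmptyRegion S

/-- The `i`-th edge of the closed walk `v 0, v 1, …, v (k - 1), v 0`. -/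
def cycleEdge {k : ℕ} (v : Fin k → V) (i : Fin k) : Sym2 V :=
  s(v i, v (finRotate k i))

/-- The closed curve formed by the edges of the cycle `v 0, v 1, …, v (k - 1), v 0`. -/
def cycle {k : ℕ} (v : Fin k → V) : Set ℂ :=
  ⋃ i, D.edge (cycleEdge v i)

/-- `v 0, v 1, …, v (k - 1), v 0` is a plane cycle of length `k`. -/
def IsPlaneCycle {k : ℕ} (v : Fin k → V) : Prop :=
  3 ≤ k ∧ Function.Injective v ∧ ∀ i j, ¬ D.Crosses (cycleEdge v i) (cycleEdge v j)

/-- The plane cycle `v` is an empty `k`-triangulation: it has an empty side which is the union of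
empty triangles with pairwise disjoint interiors. -/
def IsEmptyTriangulation {k : ℕ} (v : Fin k → V) : Prop :=
  D.IsPlaneCycle v ∧ ∃ S : Set ℂ, IsSide (D.cycle v) S ∧ D.IsEmptyRegion S ∧
    ∃ F : Set (Set ℂ), (∀ T ∈ F, D.IsEmptyTriangle T) ∧
      F.Pairwise (fun A B => Disjoint (interior A) (interior B)) ∧ S = ⋃₀ F

/-- The vertices `v 0, …, v (k - 1)` form a `k`-gon: their edges cross exactly as those of `k`
points in convex position with this cyclic order. -/
def IsGon {k : ℕ} (v : Fin k → V) : Prop :=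
  Function.Injective v ∧ ∀ i j l m : Fin k, i < j → j < l → l < m →
    D.Crosses s(v i, v l) s(v j, v m) ∧ ¬ D.Crosses s(v i, v j) s(v l, v m) ∧
      ¬ D.Crosses s(v i, v m) s(v j, v l)

/-- The set `S` is convex in the subdrawing induced by the vertex set `W`: every edge between two
vertices of `W` lying in `S` is contained in `S`. -/
def IsConvexIn (W : Set V) (S : Set ℂ) : Prop :=
  ∀ u ∈ W, ∀ w ∈ W, u ≠ w → D.pt u ∈ S → D.pt w ∈ S → D.edge s(u, w) ⊆ S

/-- The convex side of the `k`-gon (`k ≥ 4`) with vertex set `W`: the union of the convex sides,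
with respect to the subdrawing induced by `W`, of the triangles with vertices in `W`. -/
def convexSide (W : Set V) : Set ℂ :=
  ⋃₀ {S | ∃ a ∈ W, ∃ b ∈ W, ∃ c ∈ W, a ≠ b ∧ b ≠ c ∧ a ≠ c ∧
    IsSide (D.triangle a b c) S ∧ D.IsConvexIn W S}

/-- The vertices `v 0, …, v (k - 1)`, where `k ≥ 4`, form a `k`-hole: a `k`-gon without vertices
of the drawing in the interior of its convex side. -/
def IsHole {k : ℕ} (v : Fin k → V) : Prop :=
  4 ≤ k ∧ D.IsGon v ∧ D.IsEmptyRegion (D.convexSide (Set.range v))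

end SimpleDrawing

/-- The crossing pairs of edges of the modified twisted drawing on the vertices `1, …, n`, each
unordered pair of edges being listed in one order only. -/
inductive ModifiedTwistedPair (n : ℕ) : Sym2 ℕ → Sym2 ℕ → Prop
  /-- the vertices other than `2` induce a twisted drawing -/
  | twisted (i j k l : ℕ) (h1 : 1 ≤ i) (hij : i < j) (hjk : j < k) (hkl : k < l) (hn : l ≤ n)
      (hi : i ≠ 2) (hj : j ≠ 2) (hk : k ≠ 2) (hl : l ≠ 2) :
      ModifiedTwistedPair n s(i, l) s(j, k)
  | one_a : ModifiedTwistedPair n s(1, 2) s(3, n)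
  | one_b : ModifiedTwistedPair n s(1, 2) s(3, 4)
  | one_c (i : ℕ) (hi : 5 ≤ i) (hn : i ≤ n) : ModifiedTwistedPair n s(1, 2) s(4, i)
  | four : ModifiedTwistedPair n s(2, 4) s(3, n)
  | mid_a (j : ℕ) (hj : 5 ≤ j) (hn : j < n) : ModifiedTwistedPair n s(2, j) s(1, 3)
  | mid_b (j : ℕ) (hj : 5 ≤ j) (hn : j < n) : ModifiedTwistedPair n s(2, j) s(3, n)
  | mid_c (j k : ℕ) (hj : 5 ≤ j) (hn : j < n) (hjk : j < k) (hk : k ≤ n) :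
      ModifiedTwistedPair n s(2, j) s(1, k)
  | mid_d (j i k : ℕ) (hj : 5 ≤ j) (hn : j < n) (hi : 2 < i) (hik : i < k) (hk : k < j) :
      ModifiedTwistedPair n s(2, j) s(i, k)
  | last (i j : ℕ) (hi : 3 < i) (hij : i < j) (hj : j < n) :
      ModifiedTwistedPair n s(2, n) s(i, j)

/-- `D` is, up to isomorphism, the modified twisted drawing: under some labelling of its vertices
by `1, …, n`, its crossing pairs of edges are exactly those of `ModifiedTwistedPair n`. -/
def SimpleDrawing.IsModifiedTwisted {n : ℕ} (D : SimpleDrawing (Fin n)) : Prop :=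
  ∃ σ : Equiv.Perm (Fin n), ∀ e f : Sym2 (Fin n), ¬ e.IsDiag → ¬ f.IsDiag →
    (D.Crosses e f ↔
      ModifiedTwistedPair n (e.map fun v => (σ v : ℕ) + 1) (f.map fun v => (σ v : ℕ) + 1) ∨
      ModifiedTwistedPair n (f.map fun v => (σ v : ℕ) + 1) (e.map fun v => (σ v : ℕ) + 1))

/-!
The nonexistence statements rest on one property of the crossing pairs: for every crossing of edges
`ac` and `bd` there are a vertex `w` and one of `a, b, c, d`, say `d`, such that the edge `wd`
crosses exactly one edge of the triangle `abc` (`ModifiedTwistedPair.hasWitness`). Hence `abc`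
separates `w` from `d` (`SimpleDrawing.CrossesOnce.separates`), so `w` lies on the side of the
triangle not containing `d`. That side is part of the convex side of the quadrilateral, which is
therefore not empty (`SimpleDrawing.not_isHole`). For a plane `4`-cycle, whose diagonals cross
because the drawing is crossing maximal, it shows that the side of the cycle containing the crossing
of the diagonals contains `w`. The other side is no union of empty triangles either: such a triangle
would have its vertices on the cycle, and so one of its edges would be a diagonal
(`SimpleDrawing.not_isEmptyTriangulation`).

The two facts about closed curves used here are that a curve crossing a closed curve properly
changes sides (`component_ne_of_isProperCrossing`), and that each side of a closed curve has the
whole curve as its boundary if there are at least two sides (`range_subset_closure_component`).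
Both are obtained, in the manner of Borsuk, from continuous logarithms of `(z - p) / (z - q)`, whose
existence is granted by the covering `exp`; the Jordan curve theorem itself is not needed.

For the existence, consider the points of the plane above the parabola `y = x ^ 2` and fold the
parabola by identifying `(a, a ^ 2)` with `(-a, a ^ 2)`. The result is a plane
(`parabolaHomeomorph`) in which the parabola has become a half line. All vertices are put on this
half line, and each edge consists of one or two chords of the parabola (`edgeChords`). Two chords
`[a, b]` and `[c, d]` meet above the parabola exactly if the intervals interleave, and then they
cross properly in a single point. Thus what is required of the drawing becomes linear arithmetic in
the ends of the chords.
-/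

open Set

/-! ### Logarithms of functions on plane sets -/

/-- `f` has a continuous logarithm on `K`. -/
def HasLogOn (f : ℂ → ℂ) (K : Set ℂ) : Prop :=
  ∃ g : ℂ → ℂ, ContinuousOn g K ∧ ∀ z ∈ K, Complex.exp (g z) = f z

/-- The points `p` and `q` are not linked with `K`: the quotient `(z - p) / (z - q)` has a
continuous logarithm on `K`. For compact `K` this is Borsuk's criterion for `K` not to separate
`p` from `q`. -/
def Unlinked (K : Set ℂ) (p q : ℂ) : Prop :=
  HasLogOn (fun z => (z - p) / (z - q)) K

theorem HasLogOn.mono {f : ℂ → ℂ} {K L : Set ℂ} (h : HasLogOn f K) (hLK : L ⊆ K) :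
    HasLogOn f L :=
  let ⟨g, hg, he⟩ := h
  ⟨g, hg.mono hLK, fun z hz => he z (hLK hz)⟩

theorem HasLogOn.congr {f f' : ℂ → ℂ} {K : Set ℂ} (h : HasLogOn f K) (hf : ∀ z ∈ K, f z = f' z) :
    HasLogOn f' K :=
  let ⟨g, hg, he⟩ := h
  ⟨g, hg, fun z hz => (he z hz).trans (hf z hz)⟩

/-- Two continuous functions on closed sets that agree on the intersection glue. -/
theorem exists_continuousOn_union {X Y : Type*} [TopologicalSpace X] [TopologicalSpace Y]
    {A B : Set X} (hA : IsClosed A) (hB : IsClosed B) {f g : X → Y} (hf : ContinuousOn f A)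
    (hg : ContinuousOn g B) (h : ∀ x ∈ A ∩ B, f x = g x) :
    ∃ k : X → Y, ContinuousOn k (A ∪ B) ∧ (∀ x ∈ A, k x = f x) ∧ ∀ x ∈ B, k x = g x := by
  classical
  have e1 : ∀ x ∈ A, A.piecewise f g x = f x := fun x hx => A.piecewise_eq_of_mem f g hx
  have e2 : ∀ x ∈ B, A.piecewise f g x = g x := fun x hx => by
    by_cases hxA : x ∈ A
    · rw [e1 x hxA, h x ⟨hxA, hx⟩]
    · exact A.piecewise_eq_of_notMem f g hxA
  exact ⟨A.piecewise f g, (hf.congr e1).union_of_isClosed (hg.congr e2) hA hB, e1, e2⟩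

/-- A continuous function on a preconnected set whose exponential is constant is constant. -/
theorem eq_of_exp_eq {K : Set ℂ} (hK : IsPreconnected K) {g g' : ℂ → ℂ} (hg : ContinuousOn g K)
    (hg' : ContinuousOn g' K) (h : ∀ z ∈ K, Complex.exp (g z) = Complex.exp (g' z)) {z w : ℂ}
    (hz : z ∈ K) (hw : w ∈ K) : g z - g' z = g w - g' w := by
  have hd : DiscreteTopology (AddSubgroup.zmultiples (2 * Real.pi * Complex.I)) :=
    NormedSpace.discreteTopology_zmultiples _
  refine hK.constant_of_mapsTo (T := (AddSubgroup.zmultiples (2 * Real.pi * Complex.I) : Set ℂ))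
    ⟨hd⟩ (hg.sub hg') (fun x hx => ?_) hz hw
  obtain ⟨n, hn⟩ := Complex.exp_eq_exp_iff_exists_int.1 (h x hx)
  exact AddSubgroup.mem_zmultiples_iff.2 ⟨n, by simp [hn]⟩

/-- Continuous logarithms exist on simply connected, locally path-connected spaces. -/
theorem exists_continuous_log {A : Type*} [TopologicalSpace A] [SimplyConnectedSpace A]
    [LocallyPathConnectedSpace A] {f : A → ℂ} (hf : Continuous f) (h0 : ∀ a, f a ≠ 0) :
    ∃ g : A → ℂ, Continuous g ∧ ∀ a, Complex.exp (g a) = f a := by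
  obtain ⟨a₀⟩ : Nonempty A := inferInstance
  obtain ⟨F, ⟨-, hF⟩, -⟩ := Complex.isCoveringMapOn_exp.existsUnique_continuousMap_lifts ⟨f, hf⟩
    (a₀ := a₀) (e₀ := Complex.log (f a₀)) (Complex.exp_log (h0 a₀)) (fun a => h0 a)
  exact ⟨F, F.continuous, fun a => congrFun hF a⟩

theorem isPreconnected_compl_closedBall (r : ℝ) : IsPreconnected {z : ℂ | r < ‖z‖} := by
  rcases lt_or_ge r 0 with hr | hr
  · rw [Set.eq_univ_of_forall (s := {z : ℂ | r < ‖z‖}) fun z => hr.trans_le (norm_nonneg z)]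
    exact (convex_univ (𝕜 := ℝ)).isPreconnected
  have hc : Convex ℝ {u : ℂ | r < Real.exp u.re} := by
    rcases hr.eq_or_lt with rfl | hr
    · convert! convex_univ using 1
      exact Set.eq_univ_of_forall fun z => Real.exp_pos _
    · simp_rw [← Real.log_lt_iff_lt_exp hr]
      exact convex_halfSpace_re_gt _
  convert! hc.isPreconnected.image Complex.exp Complex.continuous_exp.continuousOn using 1
  ext z
  constructor
  · intro hz
    have h0 : z ≠ 0 := norm_pos_iff.1 (hr.trans_lt hz)
    exact ⟨Complex.log z, by simpa [Complex.log_re, Real.exp_log (norm_pos_iff.2 h0)] using hz,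
      Complex.exp_log h0⟩
  · rintro ⟨u, hu, rfl⟩
    simpa [Complex.norm_exp] using hu

/-- The function `z - w` has no continuous logarithm near infinity. -/
theorem not_hasLogOn_sub_of_large (w : ℂ) (r : ℝ) :
    ¬ HasLogOn (fun z => z - w) {z | r < ‖z‖} := by
  rintro ⟨g, hg, he⟩
  -- On the half plane `r + ‖w‖ < exp (re u)` compare `g (w + exp u)` with `u`.
  set c : ℝ := r + ‖w‖ with hc
  have hK : IsPreconnected {u : ℂ | |c| < u.re} := (convex_halfSpace_re_gt _).isPreconnected
  have hmem : ∀ u : ℂ, |c| < u.re → w + Complex.exp u ∈ {z : ℂ | r < ‖z‖} := by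
    intro u hu
    have h1 : c < Real.exp u.re :=
      (le_abs_self c).trans_lt (hu.trans (by linarith [Real.add_one_le_exp u.re]))
    have h2 : ‖Complex.exp u‖ ≤ ‖w + Complex.exp u‖ + ‖w‖ := by
      simpa using norm_sub_le (w + Complex.exp u) w
    rw [Complex.norm_exp] at h2
    simp only [Set.mem_ofPred_eq]
    linarith
  have hcont : ContinuousOn (fun u => g (w + Complex.exp u)) {u : ℂ | |c| < u.re} :=
    hg.comp (by fun_prop) hmem
  have key := eq_of_exp_eq hK hcont continuousOn_id (fun u hu => by
    rw [he _ (hmem u hu)]; simp) (z := ((|c| + 1 : ℝ) : ℂ))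
    (w := ((|c| + 1 : ℝ) : ℂ) + 2 * Real.pi * Complex.I)
    (by simp only [Set.mem_ofPred_eq, Complex.ofReal_re]; linarith)
    (by simp only [Set.mem_ofPred_eq, Complex.add_re, Complex.ofReal_re]; simp)
  simp only [Complex.exp_add, Complex.exp_two_pi_mul_I, mul_one, id] at key
  have : (2 * Real.pi * Complex.I : ℂ) = 0 := by linear_combination key
  simp [Real.pi_ne_zero] at this

/-- If `w` lies in a bounded open set `U` and `k` has no zeros on the closure of `U`, then
`(z - w) / k z` has no continuous logarithm on the frontier of `U`: otherwise, extending the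
logarithm over the closure of `U`, one could change `z - w` inside `U` to a function without zeros
on the whole plane, which would have a continuous logarithm. -/
theorem not_hasLogOn_frontier {U : Set ℂ} (hb : Bornology.IsBounded U) {w : ℂ}
    (hw : w ∈ U) {k : ℂ → ℂ} (hk : Continuous k) (h0 : ∀ z ∈ closure U, k z ≠ 0) :
    ¬ HasLogOn (fun z => (z - w) / k z) (frontier U) := by
  classical
  rintro ⟨g, hg, he⟩
  obtain ⟨G, hG⟩ := ContinuousMap.exists_restrict_eq (isClosed_frontier (s := U))
    ⟨(frontier U).domRestrict g, hg.domRestrict⟩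
  have hG' : ∀ z ∈ frontier U, G z = g z := fun z hz => congr($hG ⟨z, hz⟩)
  set h : ℂ → ℂ := fun z => if z ∈ closure U then k z * Complex.exp (G z) else z - w with hh
  have hcont : Continuous h := by
    refine Continuous.if (fun z hz => ?_) (by fun_prop) (by fun_prop)
    have hz' : z ∈ frontier U := frontier_closure_subset hz
    rw [hG' z hz', he z hz', mul_div_cancel₀ _ (h0 z (frontier_subset_closure hz'))]
  have hne : ∀ z, h z ≠ 0 := by
    intro z
    simp only [hh]
    split_ifs with hz
    · exact mul_ne_zero (h0 z hz) (Complex.exp_ne_zero _)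
    · exact sub_ne_zero.2 fun e => hz (subset_closure (e ▸ hw))
  obtain ⟨l, hl, hle⟩ := exists_continuous_log hcont hne
  obtain ⟨r, hr⟩ := hb.closure.exists_norm_le
  refine not_hasLogOn_sub_of_large w r ⟨l, hl.continuousOn, fun z hz => ?_⟩
  rw [hle z, hh]
  exact if_neg fun hz' => (hr z hz').not_gt hz

/-- The easy half of Borsuk's criterion. -/
theorem unlinked_of_isPreconnected {K C : Set ℂ} (hK : IsClosed K) (hC : IsPreconnected C)
    (hCK : Disjoint C K) {p q : ℂ} (hp : p ∈ C) (hq : q ∈ C) : Unlinked K p q := by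
  have hne : ∀ x ∈ C, ∀ z ∈ K, z - x ≠ 0 := fun x hx z hz e =>
    Set.disjoint_left.1 hCK hx (sub_eq_zero.1 e ▸ hz)
  have symm : ∀ x y : ℂ, Unlinked K x y → Unlinked K y x := by
    rintro x y ⟨g, hg, he⟩
    refine ⟨fun z => -g z, hg.neg, fun z hz => ?_⟩
    rw [Complex.exp_neg, he z hz, inv_div]
  have near : ∀ x ∈ C, ∀ᶠ y in nhdsWithin x C, Unlinked K y x := by
    intro x hx
    have hxK : x ∈ Kᶜ := Set.disjoint_left.1 hCK hx
    obtain ⟨ε, hε, hball⟩ := Metric.isOpen_iff.1 hK.isOpen_compl x hxK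
    filter_upwards [nhdsWithin_le_nhds (Metric.ball_mem_nhds x hε)] with y hy
    have hslit : ∀ z ∈ K, (z - y) / (z - x) ∈ Complex.slitPlane := by
      intro z hz
      have hzx := hne x hx z hz
      have h1 : ε ≤ ‖z - x‖ := by
        by_contra hlt
        exact hball (mem_ball_iff_norm.2 (not_le.1 hlt)) hz
      have h2 : (z - y) / (z - x) = 1 + (x - y) / (z - x) := by field_simp; ring
      have h3 : ‖(x - y) / (z - x)‖ < 1 := by
        rw [norm_div, div_lt_one (hε.trans_le h1), norm_sub_rev]
        exact (mem_ball_iff_norm.1 hy).trans_le h1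
      rw [h2]
      exact Complex.mem_slitPlane_of_norm_lt_one h3
    refine ⟨fun z => Complex.log ((z - y) / (z - x)), ContinuousOn.clog ?_ hslit, fun z hz => ?_⟩
    · exact ContinuousOn.div (by fun_prop) (by fun_prop) (hne x hx)
    · exact Complex.exp_log (Complex.slitPlane_ne_zero (hslit z hz))
  refine hC.induction₂' (Unlinked K) (fun x hx => ?_) ?_ hp hq
  · filter_upwards [near x hx] with y hy using ⟨symm _ _ hy, hy⟩
  · rintro x y z hx hy hz ⟨g, hg, he⟩ ⟨g', hg', he'⟩
    refine ⟨fun u => g u + g' u, hg.add hg', fun u hu => ?_⟩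
    rw [Complex.exp_add, he u hu, he' u hu]
    exact div_mul_div_cancel₀ (hne y hy u hu)

/-- Every continuous function without zeros has a continuous logarithm on `A`. -/
def IsLogSet (A : Set ℂ) : Prop :=
  ∀ f : ℂ → ℂ, ContinuousOn f A → (∀ z ∈ A, f z ≠ 0) → HasLogOn f A

/-- Compact sets on which all continuous functions without zeros have logarithms do not separate
the plane. -/
theorem IsLogSet.isPreconnected_compl {A : Set ℂ} (hA : IsLogSet A) (hc : IsCompact A) :
    IsPreconnected Aᶜ := by
  obtain ⟨r, hr⟩ := hc.isBounded.exists_norm_le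
  have hbig : {z : ℂ | r < ‖z‖} ⊆ Aᶜ := fun z hz hzA => (hr z hzA).not_gt hz
  -- a bounded part of the complement is impossible
  have key : ∀ U V : Set ℂ, IsOpen U → IsOpen V → Aᶜ ⊆ U ∪ V → (Aᶜ ∩ U).Nonempty →
      Aᶜ ∩ (U ∩ V) = ∅ → {z : ℂ | r < ‖z‖} ⊆ V → False := by
    rintro U V hU hV hUV ⟨w, hwA, hwU⟩ hd hV'
    have hsub : Aᶜ ∩ U ⊆ {z : ℂ | r < ‖z‖}ᶜ := fun z hz hz' => by
      have : z ∈ Aᶜ ∩ (U ∩ V) := ⟨hz.1, hz.2, hV' hz'⟩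
      rwa [hd] at this
    have hopen : IsOpen (Aᶜ ∩ U) := hc.isClosed.isOpen_compl.inter hU
    have hfr : frontier (Aᶜ ∩ U) ⊆ A := by
      intro z hz
      rw [hopen.frontier_eq] at hz
      by_contra hzA
      rcases hUV hzA with h | h
      · exact hz.2 ⟨hzA, h⟩
      · obtain ⟨y, hyV, hyU⟩ := mem_closure_iff.1 hz.1 (Aᶜ ∩ V)
          (hc.isClosed.isOpen_compl.inter hV) ⟨hzA, h⟩
        have : y ∈ Aᶜ ∩ (U ∩ V) := ⟨hyU.1, hyU.2, hyV.2⟩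
        rwa [hd] at this
    refine not_hasLogOn_frontier (U := Aᶜ ∩ U) ?_ ⟨hwA, hwU⟩ (k := fun _ => 1)
      continuous_const (by simp) ?_
    · refine (Metric.isBounded_closedBall (x := (0 : ℂ)) (r := r)).subset fun z hz => ?_
      simpa using hsub hz
    · refine ((hA (fun z => z - w) (by fun_prop) fun z hz e => hwA ?_).mono hfr).congr (by simp)
      exact sub_eq_zero.1 e ▸ hz
  intro U V hU hV hUV hnU hnV
  by_contra hne
  have hd := Set.not_nonempty_iff_eq_empty.1 hne
  have hpre := isPreconnected_compl_closedBall r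
  rcases isPreconnected_iff_subset_of_disjoint.1 hpre U V hU hV (hbig.trans hUV)
      (Set.subset_eq_empty (Set.inter_subset_inter_left _ hbig) hd) with h | h
  · exact key V U hV hU (Set.union_comm U V ▸ hUV) hnV (by rwa [Set.inter_comm V U]) h
  · exact key U V hU hV hUV hnU hd h

/-! ### Sides of closed curves -/

theorem isLogSet_image_Icc {γ : unitInterval → ℂ} (hc : Continuous γ)
    (hi : Function.Injective γ) {a b : unitInterval} (hab : a ≤ b) :
    IsLogSet (γ '' Icc a b) := by
  intro f hf h0
  have hmem : ∀ t, γ (projIcc a b hab t) ∈ γ '' Icc a b := fun t =>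
    mem_image_of_mem γ (projIcc a b hab t).2
  obtain ⟨l, hl, hle⟩ := exists_continuous_log
    (f := fun t : ℝ => f (γ (projIcc a b hab (projIcc 0 1 zero_le_one t))))
    (hf.comp_continuous (hc.comp (continuous_subtype_val.comp
      (continuous_projIcc.comp continuous_projIcc))) fun t => hmem _)
    (fun t => h0 _ (hmem _))
  obtain ⟨G, hG⟩ := ContinuousMap.exists_extension' (hc.isClosedEmbedding hi)
    ⟨fun t => l t, hl.comp continuous_subtype_val⟩
  refine ⟨G, G.continuous.continuousOn, ?_⟩
  rintro _ ⟨t, ht, rfl⟩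
  have h1 : G (γ t) = l t := congrFun hG t
  rw [h1, hle t, projIcc_val, projIcc_of_mem hab ht]

theorem IsLogSet.union {A B : Set ℂ} (hA : IsLogSet A) (hB : IsLogSet B) (cA : IsClosed A)
    (cB : IsClosed B) (h : (A ∩ B).Subsingleton) : IsLogSet (A ∪ B) := by
  intro f hf h0
  obtain ⟨g, hg, he⟩ := hA f (hf.mono subset_union_left) fun z hz => h0 z (.inl hz)
  obtain ⟨g', hg', he'⟩ := hB f (hf.mono subset_union_right) fun z hz => h0 z (.inr hz)
  obtain ⟨c, hc, hcA⟩ : ∃ c : ℂ, Complex.exp c = 1 ∧ ∀ x ∈ A ∩ B, g x = g' x + c := by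
    rcases h.eq_empty_or_singleton with h | ⟨q, h⟩
    · exact ⟨0, Complex.exp_zero, by simp [h]⟩
    · have hq : q ∈ A ∩ B := h ▸ mem_singleton q
      refine ⟨g q - g' q, ?_, ?_⟩
      · rw [Complex.exp_sub, he q hq.1, he' q hq.2, div_self (h0 q (.inl hq.1))]
      · rw [h]
        rintro _ rfl
        ring
  obtain ⟨k, hk, hkA, hkB⟩ := exists_continuousOn_union cA cB hg (g := fun x => g' x + c)
    (hg'.add continuousOn_const) hcA
  refine ⟨k, hk, ?_⟩
  rintro z (hz | hz)
  · rw [hkA z hz, he z hz]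
  · rw [hkB z hz]
    rw [Complex.exp_add, hc, he' z hz, mul_one]

/-- The part of the Jordan curve theorem saying that every point of the curve is in the closure of
every complementary component. Here the curve consists of an arc `γ` and a log set `R` meeting it
in its endpoints at most. If a subarc of `γ` could be avoided, then what remains of the curve would
still separate the plane, although it is a log set. -/
theorem range_subset_closure_component {γ : unitInterval → ℂ} (hc : Continuous γ)
    (hi : Function.Injective γ) {R : Set ℂ} (hR : IsCompact R) (hRl : IsLogSet R)
    (hRγ : R ∩ range γ ⊆ {γ 0, γ 1}) {x d : ℂ} (hx : x ∈ (R ∪ range γ)ᶜ) (hd : d ∈ (R ∪ range γ)ᶜ)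
    (hxd : d ∉ connectedComponentIn (R ∪ range γ)ᶜ x) :
    range γ ⊆ closure (connectedComponentIn (R ∪ range γ)ᶜ x) := by
  set J := R ∪ range γ with hJ
  set U := connectedComponentIn Jᶜ x with hU
  have hJc : IsCompact J := hR.union (isCompact_range hc)
  have hUo : IsOpen U := hJc.isClosed.isOpen_compl.connectedComponentIn
  rintro _ ⟨t, rfl⟩
  by_contra ht
  have hO : IsOpen (γ ⁻¹' (closure U)ᶜ) := isClosed_closure.isOpen_compl.preimage hc
  have hdense : Dense ((univ : Set unitInterval) \ ({0, 1} : Set unitInterval)) :=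
    dense_univ.sdiff_finite (Set.toFinite _)
  obtain ⟨t₁, ht₁, ht₁'⟩ := hdense.inter_open_nonempty _ hO ⟨t, ht⟩
  have h0 : 0 < t₁ := lt_of_le_of_ne t₁.2.1 fun e => ht₁'.2 (.inl e.symm)
  have h1 : t₁ < 1 := lt_of_le_of_ne t₁.2.2 fun e => ht₁'.2 (.inr e)
  obtain ⟨s₁, s₂, ⟨hs₁, hs₂⟩, hs⟩ :=
    (mem_nhds_iff_exists_Ioo_subset' ⟨0, h0⟩ ⟨1, h1⟩).1 (hO.mem_nhds ht₁)
  set A := (R ∪ γ '' Icc 0 s₁) ∪ γ '' Icc s₂ 1 with hA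
  have c1 : IsCompact (γ '' Icc 0 s₁) := isCompact_Icc.image hc
  have c2 : IsCompact (γ '' Icc s₂ 1) := isCompact_Icc.image hc
  have hAc : IsCompact A := (hR.union c1).union c2
  have hAl : IsLogSet A := by
    refine ((hRl.union (isLogSet_image_Icc hc hi s₁.2.1) hR.isClosed c1.isClosed ?_).union
      (isLogSet_image_Icc hc hi s₂.2.2) (hR.union c1).isClosed c2.isClosed ?_)
    · refine (subsingleton_singleton (a := γ 0)).anti ?_
      rintro _ ⟨hzR, s, hs, rfl⟩
      rcases hRγ ⟨hzR, s, rfl⟩ with h | h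
      · exact h
      · exact absurd (hi h ▸ hs.2 : (1 : unitInterval) ≤ s₁) (hs₁.trans h1).not_ge
    · refine (subsingleton_singleton (a := γ 1)).anti ?_
      rintro _ ⟨hzR | ⟨s', hs', hss'⟩, s, hs, rfl⟩
      · rcases hRγ ⟨hzR, s, rfl⟩ with h | h
        · exact absurd (hi h ▸ hs.1 : s₂ ≤ 0) (h0.trans hs₂).not_ge
        · exact h
      · exact absurd (hs.1.trans (hi hss' ▸ hs'.2)) (hs₁.trans hs₂).not_ge
  have hAJ : A ⊆ J := by
    rintro z ((hz | ⟨s, -, rfl⟩) | ⟨s, -, rfl⟩)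
    exacts [.inl hz, .inr ⟨s, rfl⟩, .inr ⟨s, rfl⟩]
  have hUJ : U ⊆ Jᶜ := connectedComponentIn_subset _ _
  have hxU : x ∈ U := mem_connectedComponentIn hx
  -- the frontier of `U` lies on the curve and avoids the subarc, hence it lies in `A`
  have hfr : closure U ⊆ U ∪ A := by
    intro z hz
    by_contra hzn
    have hzJ : z ∈ J := by
      by_contra hzJ
      obtain ⟨y, hy, hyU⟩ := mem_closure_iff.1 hz _
        (hJc.isClosed.isOpen_compl.connectedComponentIn (x := z)) (mem_connectedComponentIn hzJ)
      refine hzn (.inl ?_)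
      rw [hU, connectedComponentIn_eq hyU, ← connectedComponentIn_eq hy]
      exact mem_connectedComponentIn hzJ
    rcases hzJ with hzR | ⟨s, rfl⟩
    · exact hzn (.inr (.inl (.inl hzR)))
    · rcases le_or_gt s s₁ with h | h
      · exact hzn (.inr (.inl (.inr ⟨s, ⟨s.2.1, h⟩, rfl⟩)))
      · rcases le_or_gt s₂ s with h' | h'
        · exact hzn (.inr (.inr ⟨s, ⟨h', s.2.2⟩, rfl⟩))
        · exact hs ⟨h, h'⟩ hz
  have hdU : d ∉ closure U := fun h => (hfr h).elim hxd fun hA => hd (hAJ hA)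
  obtain ⟨z, -, hzU, hzn⟩ := hAl.isPreconnected_compl hAc U (closure U)ᶜ hUo
    isClosed_closure.isOpen_compl
    (fun z hz => by
      by_cases h : z ∈ closure U
      · exact .inl ((hfr h).resolve_right hz)
      · exact .inr h)
    ⟨x, fun h => hx (hAJ h), hxU⟩ ⟨d, fun h => hd (hAJ h), hdU⟩
  exact hzn (subset_closure hzU)

/-- A closed curve stays connected if a connected part of one of its arcs is removed. -/
theorem isPreconnected_union_range_diff {γ : unitInterval → ℂ} (hc : Continuous γ)
    (hi : Function.Injective γ) {R I : Set ℂ} (hR : IsPreconnected R) (h0 : γ 0 ∈ R)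
    (h1 : γ 1 ∈ R) (hI : IsPreconnected I) (hIγ : I ⊆ range γ) (hIR : Disjoint I R)
    (hne : I.Nonempty) : IsPreconnected (R ∪ (range γ \ I)) := by
  have hW : IsPreconnected (γ ⁻¹' I) := by
    rw [← (hc.isClosedEmbedding hi).isInducing.isPreconnected_image,
      image_preimage_eq_of_subset hIγ]
    exact hI
  have hWo := hW.ordConnected
  obtain ⟨_, hp⟩ := hne
  obtain ⟨s, rfl⟩ := hIγ hp
  have ho1 : OrdConnected {t | γ t ∉ I ∧ t ≤ s} := by
    refine ⟨fun a ha b hb t ht => ⟨fun htI => hb.1 ?_, ht.2.trans hb.2⟩⟩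
    exact hWo.out htI hp ⟨ht.2, hb.2⟩
  have ho2 : OrdConnected {t | γ t ∉ I ∧ s ≤ t} := by
    refine ⟨fun a ha b hb t ht => ⟨fun htI => ha.1 ?_, ha.2.trans ht.1⟩⟩
    exact hWo.out hp htI ⟨ha.2, ht.1⟩
  have e : R ∪ (range γ \ I) =
      (R ∪ γ '' {t | γ t ∉ I ∧ t ≤ s}) ∪ γ '' {t | γ t ∉ I ∧ s ≤ t} := by
    ext z
    constructor
    · rintro (hz | ⟨⟨t, rfl⟩, ht⟩)
      · exact .inl (.inl hz)
      · rcases le_total t s with h | h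
        · exact .inl (.inr ⟨t, ⟨ht, h⟩, rfl⟩)
        · exact .inr ⟨t, ⟨ht, h⟩, rfl⟩
    · rintro ((hz | ⟨t, ht, rfl⟩) | ⟨t, ht, rfl⟩)
      exacts [.inl hz, .inr ⟨⟨t, rfl⟩, ht.1⟩, .inr ⟨⟨t, rfl⟩, ht.1⟩]
  rw [e]
  refine IsPreconnected.union (γ 1) (.inl h1) ?_ (IsPreconnected.union (γ 0) h0 ?_ hR ?_) ?_
  · exact ⟨1, ⟨fun h => disjoint_left.1 hIR h h1, s.2.2⟩, rfl⟩
  · exact ⟨0, ⟨fun h => disjoint_left.1 hIR h h0, s.2.1⟩, rfl⟩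
  · exact ho1.isPreconnected.image γ hc.continuousOn
  · exact ho2.isPreconnected.image γ hc.continuousOn

/-- The two local sides of a closed curve at a point with a flat chart are not connected in the
complement of the curve. Let `I` be a small arc of the curve around `p`, let `K` be the rest of the
curve and `V` an arc near `p` with the ends of `I` running around the upper point. The two points
can be joined without meeting `K ∪ V`. If they could also be joined without meeting `K ∪ I`, then
logarithms on both sets would glue to one on `I ∪ V`, which surrounds just one of the points. -/
theorem chart_sides_not_connected {γ : unitInterval → ℂ} (hc : Continuous γ)
    (hi : Function.Injective γ) {R : Set ℂ} (hR : IsClosed R) (hRc : IsPreconnected R)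
    (h0 : γ 0 ∈ R) (h1 : γ 1 ∈ R) (φ : OpenPartialHomeomorph ℂ ℂ) {ε : ℝ} (hε : 0 < ε)
    (hQ : Metric.closedBall 0 ε ⊆ φ.target) (hQR : ∀ z ∈ Metric.closedBall 0 ε, φ.symm z ∉ R)
    (hγ : ∀ z ∈ Metric.closedBall 0 ε, (φ.symm z ∈ range γ ↔ z.im = 0)) {C : Set ℂ}
    (hC : IsPreconnected C) (hCJ : Disjoint C (R ∪ range γ)) {δ : ℝ} (hδ : 0 < δ) (hδε : δ < ε)
    (hp : φ.symm (δ * Complex.I) ∈ C) (hq : φ.symm (-(δ * Complex.I)) ∈ C) : False := by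
  set ψ := φ.symm with hψ
  set Q : Set ℂ := Metric.closedBall 0 ε with hQdef
  have hψc : ContinuousOn ψ Q := φ.continuousOn_symm.mono hQ
  have hψi : InjOn ψ Q := φ.symm.injOn.mono hQ
  have hbQ : Metric.ball (0 : ℂ) ε ⊆ Q := Metric.ball_subset_closedBall
  have mQ : ∀ z : ℂ, z ∈ Q ↔ ‖z‖ ≤ ε := fun z => by simp [hQdef]
  have hQc : IsCompact Q := isCompact_closedBall 0 ε
  have cim : Continuous Complex.im := Complex.continuous_im
  set I := ψ '' {z | z ∈ Q ∧ z.im = 0} with hI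
  set V := ψ '' {z | ‖z‖ = ε ∧ 0 ≤ z.im} with hV
  set Io := ψ '' {z | ‖z‖ < ε ∧ z.im = 0} with hIo
  set Ω := ψ '' {z | ‖z‖ < ε ∧ 0 < z.im} with hΩ
  set K := R ∪ (range γ \ Io) with hK
  have hIc : IsCompact I :=
    (hQc.inter_right (isClosed_eq cim continuous_const)).image_of_continuousOn
      (hψc.mono inter_subset_left)
  have hVQ : {z : ℂ | ‖z‖ = ε ∧ 0 ≤ z.im} ⊆ Q := fun z hz => (mQ z).2 hz.1.le
  have hVc : IsCompact V := by
    refine IsCompact.image_of_continuousOn ?_ (hψc.mono hVQ)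
    refine hQc.of_isClosed_subset ?_ hVQ
    exact (isClosed_eq continuous_norm continuous_const).inter (isClosed_le continuous_const cim)
  have hIγ : I ⊆ range γ := by
    rintro _ ⟨z, ⟨hz, hz0⟩, rfl⟩
    exact (hγ z hz).2 hz0
  have hIoγ : Io ⊆ range γ := by
    rintro _ ⟨z, ⟨hz, hz0⟩, rfl⟩
    exact (hγ z ((mQ z).2 hz.le)).2 hz0
  have hKc : IsClosed K := by
    have e : range γ \ Io = range γ \ ψ '' Metric.ball 0 ε := by
      ext y
      refine and_congr_right fun hy => not_congr ⟨?_, ?_⟩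
      · rintro ⟨z, hz, rfl⟩
        exact ⟨z, by simpa using hz.1, rfl⟩
      · rintro ⟨z, hz, rfl⟩
        exact ⟨z, ⟨by simpa using hz, (hγ z (hbQ hz)).1 hy⟩, rfl⟩
    rw [hK, e]
    exact hR.union ((isCompact_range hc).isClosed.sdiff
      (φ.symm.isOpen_image_of_subset_source Metric.isOpen_ball (hbQ.trans hQ)))
  have hKpre : IsPreconnected K := by
    refine isPreconnected_union_range_diff hc hi hRc h0 h1 ?_ hIoγ ?_ ?_
    · refine IsPreconnected.image ?_ ψ (hψc.mono fun z hz => (mQ z).2 hz.1.le)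
      have : {z : ℂ | ‖z‖ < ε ∧ z.im = 0} = Metric.ball 0 ε ∩ {z | z.im = 0} := by
        ext z; simp
      rw [this]
      exact ((convex_ball (0 : ℂ) ε).inter
        (convex_hyperplane Complex.imLm.isLinear 0)).isPreconnected
    · rw [disjoint_left]
      rintro _ ⟨z, hz, rfl⟩
      exact hQR z ((mQ z).2 hz.1.le)
    · exact ⟨ψ 0, 0, by simpa using hε, rfl⟩
  have nI : ‖(δ * Complex.I : ℂ)‖ = δ := by simp [abs_of_pos hδ]
  have hpQ : (δ * Complex.I : ℂ) ∈ Q := (mQ _).2 (nI.trans_le hδε.le)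
  have hqQ : -(δ * Complex.I : ℂ) ∈ Q := (mQ _).2 (by rw [norm_neg]; exact nI.trans_le hδε.le)
  -- logarithms on the whole curve and on the curve with `I` replaced by `V`
  obtain ⟨g, hg, he⟩ := unlinked_of_isPreconnected (hR.union (isCompact_range hc).isClosed) hC hCJ
    hp hq
  obtain ⟨g', hg', he'⟩ : Unlinked (K ∪ V) (ψ (δ * Complex.I)) (ψ (-(δ * Complex.I))) := by
    have hT : {z : ℂ | z.re = 0 ∧ ‖z‖ ≤ δ} ⊆ Q := fun z hz => (mQ z).2 (hz.2.trans hδε.le)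
    refine unlinked_of_isPreconnected (C := ψ '' {z | z.re = 0 ∧ ‖z‖ ≤ δ})
      (hKc.union hVc.isClosed) ?_ ?_ ⟨_, ⟨by simp, nI.le⟩, rfl⟩
      ⟨_, ⟨by simp, by rw [norm_neg]; exact nI.le⟩, rfl⟩
    · refine IsPreconnected.image ?_ ψ (hψc.mono hT)
      have : {z : ℂ | z.re = 0 ∧ ‖z‖ ≤ δ} = {z | z.re = 0} ∩ Metric.closedBall 0 δ := by
        ext z; simp
      rw [this]
      exact ((convex_hyperplane Complex.reLm.isLinear 0).inter
        (convex_closedBall 0 δ)).isPreconnected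
    · rw [disjoint_left]
      rintro _ ⟨z, hz, rfl⟩ ((h | ⟨h, h'⟩) | ⟨y, hy, hyz⟩)
      · exact hQR z (hT hz) h
      · have hz0 := (hγ z (hT hz)).1 h
        have : z = 0 := Complex.ext hz.1 hz0
        exact h' ⟨z, ⟨by rw [this]; simpa using hε, hz0⟩, rfl⟩
      · have := hψi (hVQ hy) (hT hz) hyz
        exact hz.2.not_gt (by rw [← this, hy.1]; exact hδε)
  have hKJ : K ⊆ R ∪ range γ := union_subset_union_right R sdiff_subset
  have h0K : γ 0 ∈ K := .inl h0
  have hIV : ∀ x ∈ I ∩ V, g x = g' x + (g (γ 0) - g' (γ 0)) := by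
    rintro _ ⟨⟨z, ⟨hzQ, hz0⟩, rfl⟩, y, hy, hyz⟩
    have hyz' := hψi (hVQ hy) hzQ hyz
    have hzK : ψ z ∈ K := by
      refine .inr ⟨(hγ z hzQ).2 hz0, ?_⟩
      rintro ⟨u, hu, huz⟩
      have huy : u = y := (hψi ((mQ u).2 hu.1.le) hzQ huz).trans hyz'.symm
      exact hu.1.ne (huy ▸ hy.1)
    have := eq_of_exp_eq hKpre (hg.mono hKJ) (hg'.mono subset_union_left)
      (fun x hx => (he x (hKJ hx)).trans (he' x (.inl hx)).symm) hzK h0K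
    linear_combination this
  obtain ⟨k, hk, hkI, hkV⟩ := exists_continuousOn_union hIc.isClosed hVc.isClosed
    (hg.mono (hIγ.trans subset_union_right)) (g := fun x => g' x + (g (γ 0) - g' (γ 0)))
    ((hg'.mono subset_union_right).add continuousOn_const)
    hIV
  have hΩQ : {z : ℂ | ‖z‖ < ε ∧ 0 < z.im} ⊆ Q := fun z hz => (mQ z).2 hz.1.le
  have hΩo : IsOpen Ω := φ.symm.isOpen_image_of_subset_source
    ((isOpen_lt continuous_norm continuous_const).inter (isOpen_lt continuous_const cim))
    (hΩQ.trans hQ)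
  have hcl : closure Ω ⊆ ψ '' {z | z ∈ Q ∧ 0 ≤ z.im} := by
    refine closure_minimal (image_mono fun z hz => ⟨hΩQ hz, hz.2.le⟩) ?_
    exact ((hQc.inter_right (isClosed_le continuous_const cim)).image_of_continuousOn
      (hψc.mono inter_subset_left)).isClosed
  refine not_hasLogOn_frontier (U := Ω) (w := ψ (δ * Complex.I))
    (k := fun z => z - ψ (-(δ * Complex.I))) ?_ ?_ (by fun_prop) ?_ ⟨k, hk.mono ?_, ?_⟩
  · exact (hQc.image_of_continuousOn hψc).isBounded.subset (image_mono hΩQ)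
  · exact ⟨_, ⟨nI.trans_lt hδε, by simpa using hδ⟩, rfl⟩
  · intro z hz e
    obtain ⟨y, ⟨hyQ, hy⟩, rfl⟩ := hcl hz
    rw [hψi hyQ hqQ (sub_eq_zero.1 e)] at hy
    simp at hy
    linarith
  all_goals
    have hfr : frontier Ω ⊆ I ∪ V := by
      rw [hΩo.frontier_eq]
      rintro z ⟨hz, hzΩ⟩
      obtain ⟨y, ⟨hyQ, hy⟩, rfl⟩ := hcl hz
      rcases ((mQ y).1 hyQ).eq_or_lt with h | h
      · exact .inr ⟨y, ⟨h, hy⟩, rfl⟩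
      · rcases hy.eq_or_lt with h' | h'
        · exact .inl ⟨y, ⟨hyQ, h'.symm⟩, rfl⟩
        · exact absurd ⟨y, ⟨h, h'⟩, rfl⟩ hzΩ
  · exact hfr
  · intro z hz
    rcases hfr hz with h | h
    · rw [hkI z h, he z (.inr (hIγ h))]
    · rw [hkV z h]
      rw [Complex.exp_add, Complex.exp_sub, he _ (hKJ h0K), ← he' _ (.inl h0K),
        div_self (Complex.exp_ne_zero _), mul_one, he' z (.inr h)]

/-- A curve `E` that meets the closed curve `R ∪ range γ` outside `R` only in a proper crossing with
the arc `γ` joins two different sides of it. -/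
theorem component_ne_of_isProperCrossing {γ : unitInterval → ℂ} (hc : Continuous γ)
    (hi : Function.Injective γ) {R E E₁ E₂ : Set ℂ} (hR : IsClosed R) (hRc : IsPreconnected R)
    (h0 : γ 0 ∈ R) (h1 : γ 1 ∈ R) {p : ℂ} (hp : p ∈ range γ) (hpR : p ∉ R)
    (hcr : IsProperCrossing (range γ) E p) (hE : E \ R ⊆ {p} ∪ (E₁ ∪ E₂))
    (hE₁ : IsPreconnected E₁) (hE₂ : IsPreconnected E₂) (hd₁ : Disjoint E₁ (R ∪ range γ))
    (hd₂ : Disjoint E₂ (R ∪ range γ)) {w d : ℂ} (hw : w ∈ E₁) (hd : d ∈ E₂) :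
    connectedComponentIn (R ∪ range γ)ᶜ w ≠ connectedComponentIn (R ∪ range γ)ᶜ d := by
  intro heq
  obtain ⟨φ, hps, hp0, hφ⟩ := hcr
  have h0t : (0 : ℂ) ∈ φ.target := hp0 ▸ φ.map_source hps
  have hps0 : φ.symm 0 = p := by rw [← hp0, φ.left_inv hps]
  have hN : φ.target ∩ φ.symm ⁻¹' Rᶜ ∈ nhds (0 : ℂ) :=
    (φ.isOpen_inter_preimage_symm hR.isOpen_compl).mem_nhds ⟨h0t, by simpa [hps0] using hpR⟩
  obtain ⟨ε, hε, hball⟩ := Metric.nhds_basis_closedBall.mem_iff.1 hN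
  have hsrc : ∀ z ∈ Metric.closedBall 0 ε, φ.symm z ∈ φ.source ∧ φ (φ.symm z) = z := fun z hz =>
    ⟨φ.map_target (hball hz).1, φ.right_inv (hball hz).1⟩
  have hγ : ∀ z ∈ Metric.closedBall 0 ε, (φ.symm z ∈ range γ ↔ z.im = 0) := fun z hz => by
    rw [(hφ _ (hsrc z hz).1).1, (hsrc z hz).2]
  have hEC : E₁ ∪ E₂ ⊆ connectedComponentIn (R ∪ range γ)ᶜ w := by
    refine union_subset (hE₁.subset_connectedComponentIn hw hd₁.subset_compl_right) ?_
    rw [heq]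
    exact hE₂.subset_connectedComponentIn hd hd₂.subset_compl_right
  have key : ∀ y : ℝ, y ≠ 0 → |y| ≤ ε →
      φ.symm (y * Complex.I) ∈ connectedComponentIn (R ∪ range γ)ᶜ w := by
    intro y hy hyε
    have hz : (y * Complex.I : ℂ) ∈ Metric.closedBall 0 ε := by simpa using hyε
    have hzE : φ.symm (y * Complex.I) ∈ E := by
      rw [(hφ _ (hsrc _ hz).1).2, (hsrc _ hz).2]
      simp
    rcases hE ⟨hzE, (hball hz).2⟩ with h | h
    · have := (hγ _ hz).1 (h ▸ hp)
      simp [hy] at this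
    · exact hEC h
  refine chart_sides_not_connected hc hi hR hRc h0 h1 φ hε (fun z hz => (hball hz).1)
    (fun z hz => (hball hz).2) hγ isPreconnected_connectedComponentIn
    (disjoint_left.2 fun z hz => connectedComponentIn_subset _ _ hz) (half_pos hε) (half_lt_self hε)
    (key (ε / 2) (by positivity) (by rw [abs_of_pos (half_pos hε)]; linarith)) ?_
  have h := key (-(ε / 2)) (by simpa using hε.ne') (by
    rw [abs_neg, abs_of_pos (half_pos hε)]; linarith)
  rwa [Complex.ofReal_neg, neg_mul] at h

/-! ### Triangles in simple drawings -/

namespace SimpleDrawing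

variable {V : Type*} (D : SimpleDrawing V)

theorem pt_left_mem {u v : V} (h : u ≠ v) : D.pt u ∈ D.edge s(u, v) := by
  obtain ⟨γ, -, -, h0, -, hr⟩ := D.edge_arc u v h
  exact hr ▸ ⟨0, h0⟩

theorem pt_right_mem {u v : V} (h : u ≠ v) : D.pt v ∈ D.edge s(u, v) := by
  rw [Sym2.eq_swap]
  exact D.pt_left_mem h.symm

theorem isCompact_edge {u v : V} (h : u ≠ v) : IsCompact (D.edge s(u, v)) := by
  obtain ⟨γ, hc, -, -, -, hr⟩ := D.edge_arc u v h
  exact hr ▸ isCompact_range hc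

theorem isPreconnected_edge {u v : V} (h : u ≠ v) : IsPreconnected (D.edge s(u, v)) := by
  obtain ⟨γ, hc, -, -, -, hr⟩ := D.edge_arc u v h
  exact hr ▸ isPreconnected_range hc

theorem isLogSet_edge {u v : V} (h : u ≠ v) : IsLogSet (D.edge s(u, v)) := by
  obtain ⟨γ, hc, hi, -, -, hr⟩ := D.edge_arc u v h
  have := isLogSet_image_Icc hc hi (zero_le_one (α := unitInterval))
  rwa [show Icc (0 : unitInterval) 1 = univ from eq_univ_of_forall fun t => t.2, image_univ,
    hr] at this

theorem isPreconnected_edge_diff_right {u v : V} (h : u ≠ v) :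
    IsPreconnected (D.edge s(u, v) \ {D.pt v}) := by
  obtain ⟨γ, hc, hi, -, h1, hr⟩ := D.edge_arc u v h
  have : D.edge s(u, v) \ {D.pt v} = γ '' Iio 1 := by
    rw [← hr, ← h1]
    ext z
    constructor
    · rintro ⟨⟨t, rfl⟩, ht⟩
      exact ⟨t, lt_of_le_of_ne t.2.2 fun e => ht (congrArg γ (Subtype.ext e)), rfl⟩
    · rintro ⟨t, ht, rfl⟩
      exact ⟨⟨t, rfl⟩, fun e => ht.ne (hi e)⟩
  rw [this]
  exact ordConnected_Iio.isPreconnected.image γ hc.continuousOn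

/-- Two edges with a common vertex have no other common point. -/
theorem edge_inter_of_adjacent {u v w : V} (huv : u ≠ v) (huw : u ≠ w) (hvw : v ≠ w) :
    D.edge s(u, v) ∩ D.edge s(u, w) ⊆ {D.pt u} := fun _ hp =>
  D.edge_inter s(u, v) s(u, w) (by simpa) (by simpa) (by simp [huw, hvw]) hp
    ⟨D.pt_left_mem huv, D.pt_left_mem huw⟩

/-- Two edges that neither cross nor have a common vertex are disjoint. -/
theorem disjoint_edge_of_not_crosses {e f : Sym2 V} (he : ¬ e.IsDiag) (hf : ¬ f.IsDiag)
    (hef : ∀ v ∈ e, v ∉ f) (h : ¬ D.Crosses e f) : Disjoint (D.edge e) (D.edge f) := by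
  rw [disjoint_left]
  intro p hp hp'
  have hne : e ≠ f := by
    rintro rfl
    obtain ⟨u, v⟩ := e
    exact hef u (Sym2.mem_mk_left u v) (Sym2.mem_mk_left u v)
  refine h ⟨hne, p, ⟨hp, hp'⟩, ?_⟩
  rintro ⟨v, rfl⟩
  exact hef v (D.edge_vertex e he v hp) (D.edge_vertex f hf v hp')

theorem Crosses.symm {D : SimpleDrawing V} {e f : Sym2 V} (h : D.Crosses e f) : D.Crosses f e :=
  ⟨h.1.symm, h.2.imp fun _ hp => ⟨hp.1.symm, hp.2⟩⟩

theorem Crosses.isProperCrossing {D : SimpleDrawing V} {e f : Sym2 V} (h : e ≠ f)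
    (he : ¬ e.IsDiag) (hf : ¬ f.IsDiag) {p : ℂ} (hp : p ∈ D.edge e ∩ D.edge f)
    (hpt : p ∉ range D.pt) : IsProperCrossing (D.edge e) (D.edge f) p :=
  (D.edge_common e f he hf h p hp).resolve_left fun ⟨v, _, _, hv⟩ => hpt ⟨v, hv⟩

theorem triangle_rotate (a b c : V) : D.triangle b c a = D.triangle a b c := by
  simp only [triangle, Sym2.eq_swap (a := c) (b := a), Sym2.eq_swap (a := b) (b := a)]
  rw [union_right_comm, union_comm, ← union_assoc, union_right_comm]
  ext z; simp only [mem_union]; tauto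

theorem triangle_eq (a b c : V) :
    D.triangle a b c = (D.edge s(a, b) ∪ D.edge s(a, c)) ∪ D.edge s(b, c) :=
  union_right_comm _ _ _

theorem isClosed_triangle {a b c : V} (hab : a ≠ b) (hbc : b ≠ c) (hac : a ≠ c) :
    IsClosed (D.triangle a b c) :=
  (((D.isCompact_edge hab).union (D.isCompact_edge hbc)).union (D.isCompact_edge hac)).isClosed

theorem pt_notMem_triangle {a b c w : V} (hab : a ≠ b) (hbc : b ≠ c) (hac : a ≠ c) (ha : w ≠ a)
    (hb : w ≠ b) (hc : w ≠ c) : D.pt w ∉ D.triangle a b c := by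
  rintro ((h | h) | h)
  · simpa [ha, hb] using D.edge_vertex _ (by simpa) w h
  · simpa [hb, hc] using D.edge_vertex _ (by simpa) w h
  · simpa [ha, hc] using D.edge_vertex _ (by simpa) w h

/-- Near a crossing with the edge `bc`, an edge that does not meet the rest of the triangle `abc`,
except possibly in its endpoint `y`, passes from one side of the triangle to another. -/
theorem exists_component_ne_of_crosses {a b c x y : V} (hab : a ≠ b) (hbc : b ≠ c) (hac : a ≠ c)
    (hxy : x ≠ y) (hcr : D.Crosses s(b, c) s(x, y))
    (hR : D.edge s(x, y) ∩ (D.edge s(a, b) ∪ D.edge s(a, c)) ⊆ {D.pt y}) :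
    ∃ z ∈ (D.triangle a b c)ᶜ,
      connectedComponentIn (D.triangle a b c)ᶜ (D.pt x) ≠
        connectedComponentIn (D.triangle a b c)ᶜ z ∧
      (y ≠ a → y ≠ b → y ≠ c → z = D.pt y) := by
  obtain ⟨hne, p, ⟨hp1, hp2⟩, hpt⟩ := hcr
  have hpr := Crosses.isProperCrossing hne (by simpa) (by simpa) ⟨hp1, hp2⟩ hpt
  have hsub := D.edge_inter s(b, c) s(x, y) (by simpa) (by simpa) hne
  obtain ⟨γ, hγc, hγi, hγ0, hγ1, hγ⟩ := D.edge_arc b c hbc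
  obtain ⟨η, hηc, hηi, hη0, hη1, hη⟩ := D.edge_arc x y hxy
  obtain ⟨s, hs⟩ : p ∈ range η := hη ▸ hp2
  have hs0 : 0 < s := lt_of_le_of_ne s.2.1 fun e => hpt ⟨x, by rw [← hη0, ← hs, ← e]⟩
  have hs1 : s < 1 := lt_of_le_of_ne s.2.2 fun e => hpt ⟨y, by rw [← hη1, ← hs, e]⟩
  set R := D.edge s(a, b) ∪ D.edge s(a, c) with hRdef
  have hpR : p ∉ R := fun h => hpt ⟨y, (hR ⟨hp2, h⟩).symm⟩
  have hηE : ∀ t, η t ∈ D.edge s(x, y) := fun t => hη ▸ ⟨t, rfl⟩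
  have hbc' : ∀ t, t ≠ s → η t ∉ D.edge s(b, c) := fun t ht h =>
    ht (hηi ((hsub ⟨h, hηE t⟩ ⟨hp1, hp2⟩).trans hs.symm))
  -- the last part of the edge, without its endpoint if that lies on the triangle
  set T : Set unitInterval := {t | s < t ∧ η t ∉ R} with hT
  have hTR : ∀ t, t ≠ 1 → η t ∉ R := fun t ht h => ht (hηi ((hR ⟨hηE t, h⟩).trans hη1.symm))
  have hTo : OrdConnected T := by
    refine ⟨fun t ht t' ht' u hu => ⟨ht.1.trans_le hu.1, fun hR' => ?_⟩⟩
    have hu1 : u = 1 := by_contra fun h => hTR u h hR'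
    have : t' = u := le_antisymm (hu1 ▸ t'.2.2) hu.2
    exact ht'.2 (this ▸ hR')
  have hRpre : IsPreconnected R := (D.isPreconnected_edge hab).union (D.pt a) (D.pt_left_mem hab)
    (D.pt_left_mem hac) (D.isPreconnected_edge hac)
  have hRcl : IsClosed R := ((D.isCompact_edge hab).union (D.isCompact_edge hac)).isClosed
  have key : ∀ z ∈ η '' T, connectedComponentIn (D.triangle a b c)ᶜ (D.pt x) ≠
        connectedComponentIn (D.triangle a b c)ᶜ z := by
    intro z hz
    rw [triangle_eq, ← hRdef, ← hγ]
    refine component_ne_of_isProperCrossing hγc hγi hRcl hRpre (E := D.edge s(x, y))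
      (E₁ := η '' Iio s) (E₂ := η '' T) ?_ ?_ (hγ.symm ▸ hp1) hpR (hγ.symm ▸ hpr) ?_
      (ordConnected_Iio.isPreconnected.image η hηc.continuousOn)
      (hTo.isPreconnected.image η hηc.continuousOn) ?_ ?_ ⟨0, hs0, hη0⟩ hz
    · rw [hγ0]; exact .inl (D.pt_right_mem hab)
    · rw [hγ1]; exact .inr (D.pt_right_mem hac)
    · rw [← hη]
      rintro _ ⟨⟨t, rfl⟩, ht⟩
      rcases lt_trichotomy t s with h | h | h
      · exact .inr (.inl ⟨t, h, rfl⟩)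
      · exact .inl (h ▸ hs)
      · exact .inr (.inr ⟨t, ⟨h, ht⟩, rfl⟩)
    · rw [hγ, disjoint_left]
      rintro _ ⟨t, ht, rfl⟩ (h | h)
      · exact hTR t (ht.trans hs1).ne h
      · exact hbc' t (ne_of_lt ht) h
    · rw [hγ, disjoint_left]
      rintro _ ⟨t, ht, rfl⟩ (h | h)
      · exact ht.2 h
      · exact hbc' t ht.1.ne' h
  have hTJ : ∀ t ∈ T, η t ∈ (D.triangle a b c)ᶜ := fun t ht h => by
    rw [triangle_eq] at h
    exact h.elim ht.2 (hbc' t ht.1.ne')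
  by_cases hy : y ≠ a ∧ y ≠ b ∧ y ≠ c
  · have hyR : D.pt y ∉ R := fun h =>
      D.pt_notMem_triangle hab hbc hac hy.1 hy.2.1 hy.2.2 (by rw [triangle_eq]; exact .inl h)
    have h1T : (1 : unitInterval) ∈ T := ⟨hs1, hη1.symm ▸ hyR⟩
    exact ⟨D.pt y, hη1 ▸ hTJ 1 h1T, key _ ⟨1, h1T, hη1⟩, fun _ _ _ => rfl⟩
  · obtain ⟨t, hst, ht1⟩ := exists_between hs1
    have htT : t ∈ T := ⟨hst, hTR t ht1.ne⟩
    exact ⟨η t, hTJ t htT, key _ ⟨t, htT, rfl⟩, fun h h' h'' => absurd ⟨h, h', h''⟩ hy⟩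

/-- The edge `xy` crosses `bc` but none of the other edges of the triangle `abc`. -/
def CrossesOnce (a b c x y : V) : Prop :=
  D.Crosses s(b, c) s(x, y) ∧ ¬ D.Crosses s(a, b) s(x, y) ∧ ¬ D.Crosses s(a, c) s(x, y)

/-- The vertices `x` and `y` lie on different sides of the triangle `abc`. -/
def Separates (a b c x y : V) : Prop :=
  connectedComponentIn (D.triangle a b c)ᶜ (D.pt x) ≠
    connectedComponentIn (D.triangle a b c)ᶜ (D.pt y)

theorem CrossesOnce.separates {D : SimpleDrawing V} {a b c x y : V} (hab : a ≠ b) (hbc : b ≠ c)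
    (hac : a ≠ c) (hxy : x ≠ y) (hx : x ≠ a ∧ x ≠ b ∧ x ≠ c) (hy : y ≠ a ∧ y ≠ b ∧ y ≠ c)
    (h : D.CrossesOnce a b c x y) : D.Separates a b c x y := by
  have h1 : Disjoint (D.edge s(a, b)) (D.edge s(x, y)) :=
    D.disjoint_edge_of_not_crosses (by simpa) (by simpa) (by aesop) h.2.1
  have h2 : Disjoint (D.edge s(a, c)) (D.edge s(x, y)) :=
    D.disjoint_edge_of_not_crosses (by simpa) (by simpa) (by aesop) h.2.2
  obtain ⟨z, -, hz, hzy⟩ := D.exists_component_ne_of_crosses hab hbc hac hxy h.1 (by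
    rintro z ⟨hz, hz' | hz'⟩
    · exact absurd hz (disjoint_left.1 h1 hz')
    · exact absurd hz (disjoint_left.1 h2 hz'))
  rwa [hzy hy.1 hy.2.1 hy.2.2] at hz

/-- The sides of a triangle have the whole triangle as their boundary. -/
theorem triangle_subset_closure {a b c : V} (hab : a ≠ b) (hbc : b ≠ c) (hac : a ≠ c) {x d : ℂ}
    (hx : x ∈ (D.triangle a b c)ᶜ) (hd : d ∈ (D.triangle a b c)ᶜ)
    (hxd : connectedComponentIn (D.triangle a b c)ᶜ x ≠
      connectedComponentIn (D.triangle a b c)ᶜ d) :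
    D.triangle a b c ⊆ closure (connectedComponentIn (D.triangle a b c)ᶜ x) := by
  have key : ∀ {a b c : V}, a ≠ b → b ≠ c → a ≠ c → x ∈ (D.triangle a b c)ᶜ →
      d ∈ (D.triangle a b c)ᶜ → connectedComponentIn (D.triangle a b c)ᶜ x ≠
        connectedComponentIn (D.triangle a b c)ᶜ d →
      D.edge s(b, c) ⊆ closure (connectedComponentIn (D.triangle a b c)ᶜ x) := by
    intro a b c hab hbc hac hx hd hxd
    obtain ⟨γ, hγc, hγi, hγ0, hγ1, hγ⟩ := D.edge_arc b c hbc
    rw [triangle_eq, ← hγ] at hx hd hxd ⊢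
    refine range_subset_closure_component hγc hγi
      ((D.isCompact_edge hab).union (D.isCompact_edge hac)) ?_ ?_ hx hd
      fun h => hxd (connectedComponentIn_eq h)
    · exact (D.isLogSet_edge hab).union (D.isLogSet_edge hac) (D.isCompact_edge hab).isClosed
        (D.isCompact_edge hac).isClosed
        (subsingleton_singleton.anti (D.edge_inter_of_adjacent hab hac hbc))
    · rw [hγ, hγ0, hγ1]
      rintro z ⟨hz | hz, hz'⟩
      · rw [Sym2.eq_swap] at hz
        exact .inl (D.edge_inter_of_adjacent hab.symm hbc hac ⟨hz, hz'⟩)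
      · rw [Sym2.eq_swap] at hz hz'
        exact .inr (D.edge_inter_of_adjacent hac.symm hbc.symm hab ⟨hz, hz'⟩)
  have e1 := D.triangle_rotate a b c
  have e2 := (D.triangle_rotate b c a).trans e1
  have k1 := key hab hbc hac hx hd hxd
  have k2 := key (a := b) (b := c) (c := a) hbc hac.symm hab.symm (by rwa [e1]) (by rwa [e1])
    (by rwa [e1])
  have k3 := key (a := c) (b := a) (c := b) hac.symm hab hbc.symm (by rwa [e2]) (by rwa [e2])
    (by rwa [e2])
  rw [e1, Sym2.eq_swap] at k2
  rw [e2] at k3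
  exact union_subset (union_subset k3 k1) k2

/-- In a crossing maximal drawing with at least four vertices each triangle has two sides. -/
theorem CrossingMaximal.exists_component_ne {D : SimpleDrawing V} (hD : D.CrossingMaximal)
    {a b c w : V} (hab : a ≠ b) (hbc : b ≠ c) (hac : a ≠ c) (hw : w ≠ a ∧ w ≠ b ∧ w ≠ c) :
    ∃ x ∈ (D.triangle a b c)ᶜ, ∃ z ∈ (D.triangle a b c)ᶜ,
      connectedComponentIn (D.triangle a b c)ᶜ x ≠ connectedComponentIn (D.triangle a b c)ᶜ z := by
  have key : ∀ {a b c : V}, a ≠ b → b ≠ c → a ≠ c → w ≠ a ∧ w ≠ b ∧ w ≠ c →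
      D.Crosses s(b, c) s(w, a) → ∃ x ∈ (D.triangle a b c)ᶜ, ∃ z ∈ (D.triangle a b c)ᶜ,
        connectedComponentIn (D.triangle a b c)ᶜ x ≠
          connectedComponentIn (D.triangle a b c)ᶜ z := by
    intro a b c hab hbc hac hw hcr
    obtain ⟨z, hz, hne, -⟩ := D.exists_component_ne_of_crosses hab hbc hac hw.1 hcr (by
      rw [Sym2.eq_swap]
      rintro z ⟨hz, hz' | hz'⟩
      · exact D.edge_inter_of_adjacent hw.1.symm hab hw.2.1 ⟨hz, hz'⟩
      · exact D.edge_inter_of_adjacent hw.1.symm hac hw.2.2 ⟨hz, hz'⟩)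
    exact ⟨_, D.pt_notMem_triangle hab hbc hac hw.1 hw.2.1 hw.2.2, z, hz, hne⟩
  have e1 := D.triangle_rotate a b c
  have e2 := (D.triangle_rotate b c a).trans e1
  rcases hD w a b c (by simp [hab, hbc, hac, hw]) with h | h | h
  · exact key hab hbc hac hw h.symm
  · rw [← e1]
    exact key hbc hac.symm hab.symm ⟨hw.2.1, hw.2.2, hw.1⟩ (Sym2.eq_swap (a := a) ▸ h.symm)
  · rw [← e2]
    exact key hac.symm hab hbc.symm ⟨hw.2.2, hw.1, hw.2.1⟩ h.symm

end SimpleDrawing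

/-! ### Quadrilaterals in simple drawings -/

namespace SimpleDrawing

variable {V : Type*} (D : SimpleDrawing V)

/-- Some further vertex is separated from one of the vertices `a, b, c, d` by the triangle spanned
by the other three. -/
def OppositeSeparated (a b c d : V) : Prop :=
  ∃ w, (w ≠ a ∧ w ≠ b ∧ w ≠ c ∧ w ≠ d) ∧ (D.Separates a b c w d ∨ D.Separates b c d w a ∨
    D.Separates c d a w b ∨ D.Separates d a b w c)

theorem pt_notMem_closure_of_separates {a b c w d : V} (hab : a ≠ b) (hbc : b ≠ c) (hac : a ≠ c)
    (hd : d ≠ a ∧ d ≠ b ∧ d ≠ c) (h : D.Separates a b c w d) :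
    D.pt d ∉ closure (connectedComponentIn (D.triangle a b c)ᶜ (D.pt w)) := by
  intro hcl
  obtain ⟨y, hy, hy'⟩ := mem_closure_iff.1 hcl _
    ((D.isClosed_triangle hab hbc hac).isOpen_compl.connectedComponentIn (x := D.pt d))
    (mem_connectedComponentIn (D.pt_notMem_triangle hab hbc hac hd.1 hd.2.1 hd.2.2))
  exact h ((connectedComponentIn_eq hy').trans (connectedComponentIn_eq hy).symm)

theorem mem_interior_closure_component {J : Set ℂ} (hJ : IsClosed J) {x : ℂ} (hx : x ∈ Jᶜ) :
    x ∈ interior (closure (connectedComponentIn Jᶜ x)) :=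
  mem_interior.2 ⟨_, subset_closure, hJ.isOpen_compl.connectedComponentIn,
    mem_connectedComponentIn hx⟩

/-- The side of the triangle `abc` that does not contain `d` is part of the convex side of a
quadrilateral `abcd`, as it contains no edges of it except those of the triangle. -/
theorem not_isEmptyRegion_convexSide {a b c d w : V} (hab : a ≠ b) (hbc : b ≠ c) (hac : a ≠ c)
    (hd : d ≠ a ∧ d ≠ b ∧ d ≠ c) (hw : w ≠ a ∧ w ≠ b ∧ w ≠ c) (h : D.Separates a b c w d) :
    ¬ D.IsEmptyRegion (D.convexSide {a, b, c, d}) := by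
  intro hemp
  have hwJ := D.pt_notMem_triangle hab hbc hac hw.1 hw.2.1 hw.2.2
  have hdJ := D.pt_notMem_triangle hab hbc hac hd.1 hd.2.1 hd.2.2
  have hJ := D.triangle_subset_closure hab hbc hac hwJ hdJ h
  have hdS := D.pt_notMem_closure_of_separates hab hbc hac hd h
  refine hemp w (interior_mono ?_
    (mem_interior_closure_component (D.isClosed_triangle hab hbc hac) hwJ))
  refine subset_sUnion_of_mem ⟨a, by simp, b, by simp, c, by simp, hab, hbc, hac,
    ⟨_, hwJ, rfl⟩, ?_⟩
  have e1 : D.edge s(a, b) ⊆ D.triangle a b c := fun z hz => .inl (.inl hz)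
  have e2 : D.edge s(b, c) ⊆ D.triangle a b c := fun z hz => .inl (.inr hz)
  have e3 : D.edge s(a, c) ⊆ D.triangle a b c := fun z hz => .inr hz
  rintro u (rfl | rfl | rfl | rfl) u' (rfl | rfl | rfl | rfl) huu hu hu'
  all_goals first
    | exact absurd rfl huu
    | exact absurd hu hdS
    | exact absurd hu' hdS
    | exact e1.trans hJ
    | exact e2.trans hJ
    | exact e3.trans hJ
    | (rw [Sym2.eq_swap]; exact e1.trans hJ)
    | (rw [Sym2.eq_swap]; exact e2.trans hJ)
    | (rw [Sym2.eq_swap]; exact e3.trans hJ)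

theorem not_isHole (h : ∀ a b c d : V, [a, b, c, d].Nodup → D.Crosses s(a, c) s(b, d) →
    D.OppositeSeparated a b c d) (v : Fin 4 → V) : ¬ D.IsHole v := by
  rintro ⟨-, ⟨hinj, hgon⟩, hemp⟩
  have hne : ∀ i j : Fin 4, i ≠ j → v i ≠ v j := fun i j hij e => hij (hinj e)
  have h01 := hne 0 1 (by decide)
  have h02 := hne 0 2 (by decide)
  have h03 := hne 0 3 (by decide)
  have h12 := hne 1 2 (by decide)
  have h13 := hne 1 3 (by decide)
  have h23 := hne 2 3 (by decide)
  have hW : range v = {v 0, v 1, v 2, v 3} := by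
    ext x
    simp only [mem_range, Fin.exists_fin_succ, mem_insert_iff, mem_singleton_iff, eq_comm (a := x)]
    simp
  obtain ⟨w, ⟨w0, w1, w2, w3⟩, hs⟩ := h (v 0) (v 1) (v 2) (v 3) (by simp_all)
    (hgon 0 1 2 3 (by decide) (by decide) (by decide)).1
  rw [hW] at hemp
  rcases hs with hs | hs | hs | hs
  · exact D.not_isEmptyRegion_convexSide h01 h12 h02 ⟨h03.symm, h13.symm, h23.symm⟩
      ⟨w0, w1, w2⟩ hs hemp
  · refine D.not_isEmptyRegion_convexSide h12 h23 h13 ⟨h01, h02, h03⟩ ⟨w1, w2, w3⟩ hs ?_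
    convert hemp using 2
    ext x; simp only [mem_insert_iff, mem_singleton_iff]; tauto
  · refine D.not_isEmptyRegion_convexSide h23 h03.symm h02.symm ⟨h12, h13, h01.symm⟩
      ⟨w2, w3, w0⟩ hs ?_
    convert hemp using 2
    ext x; simp only [mem_insert_iff, mem_singleton_iff]; tauto
  · refine D.not_isEmptyRegion_convexSide h03.symm h01 h13.symm ⟨h23, h02.symm, h12.symm⟩
      ⟨w3, w0, w1⟩ hs ?_
    convert hemp using 2
    ext x; simp only [mem_insert_iff, mem_singleton_iff]; tauto

/-- In a plane quadrilateral `abcd`, the side of the triangle `abc` that does not contain `d` is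
part of the side of the quadrilateral that contains an inner point `p` of the diagonal `ac`. -/
theorem pt_mem_component_of_separates {a b c d w : V} (hab : a ≠ b) (hbc : b ≠ c) (hac : a ≠ c)
    (hd : d ≠ a ∧ d ≠ b ∧ d ≠ c) (hw : w ≠ a ∧ w ≠ b ∧ w ≠ c) (h : D.Separates a b c w d)
    (h1 : ¬ D.Crosses s(a, b) s(c, d)) (h2 : ¬ D.Crosses s(b, c) s(d, a)) {C : Set ℂ}
    (hC : C = D.edge s(a, b) ∪ D.edge s(b, c) ∪ D.edge s(c, d) ∪ D.edge s(d, a)) {p : ℂ}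
    (hp : p ∈ D.edge s(a, c)) (hpC : p ∉ C) : D.pt w ∈ connectedComponentIn Cᶜ p := by
  have hwJ := D.pt_notMem_triangle hab hbc hac hw.1 hw.2.1 hw.2.2
  have hdJ := D.pt_notMem_triangle hab hbc hac hd.1 hd.2.1 hd.2.2
  have hJ := D.triangle_subset_closure hab hbc hac hwJ hdJ h
  set J := D.triangle a b c with hJdef
  set T := connectedComponentIn Jᶜ (D.pt w) with hT
  have hTJ : T ⊆ Jᶜ := connectedComponentIn_subset _ _
  -- the edges at `d` are on the other side of the triangle
  have hdT : ∀ S : Set ℂ, IsPreconnected S → D.pt d ∈ S → Disjoint S J → Disjoint S T := by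
    intro S hS hdS hSJ
    rw [disjoint_left]
    intro z hz hzT
    have h' := hS.subset_connectedComponentIn hdS hSJ.subset_compl_right hz
    exact h ((connectedComponentIn_eq hzT).trans (connectedComponentIn_eq h').symm)
  have hcd : Disjoint (D.edge s(c, d)) T := by
    have := hdT _ (D.isPreconnected_edge_diff_right hd.2.2)
      ⟨D.pt_left_mem hd.2.2, fun e => hd.2.2 (D.pt_injective e)⟩ (by
        rw [disjoint_left]
        rintro z ⟨hz, hzc⟩ ((hz' | hz') | hz')
        · rw [Sym2.eq_swap] at hz
          refine disjoint_left.1 (D.disjoint_edge_of_not_crosses ?_ ?_ ?_ h1) hz' hz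
          · simpa
          · simpa using hd.2.2.symm
          · simp [hac, hbc, hd.1.symm, hd.2.1.symm]
        · rw [Sym2.eq_swap] at hz hz'
          exact hzc (D.edge_inter_of_adjacent hd.2.2.symm hbc.symm hd.2.1 ⟨hz, hz'⟩)
        · rw [Sym2.eq_swap] at hz hz'
          exact hzc (D.edge_inter_of_adjacent hd.2.2.symm hac.symm hd.1 ⟨hz, hz'⟩))
    rw [disjoint_left]
    intro z hz hzT
    rw [Sym2.eq_swap] at hz
    refine disjoint_left.1 this ⟨hz, ?_⟩ hzT
    rintro rfl
    exact hTJ hzT (.inr (D.pt_right_mem hac))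
  have hda : Disjoint (D.edge s(d, a)) T := by
    have := hdT _ (D.isPreconnected_edge_diff_right hd.1)
      ⟨D.pt_left_mem hd.1, fun e => hd.1 (D.pt_injective e)⟩ (by
        rw [disjoint_left]
        rintro z ⟨hz, hzc⟩ ((hz' | hz') | hz')
        · rw [Sym2.eq_swap] at hz
          exact hzc (D.edge_inter_of_adjacent hd.1.symm hab hd.2.1 ⟨hz, hz'⟩)
        · refine disjoint_left.1 (D.disjoint_edge_of_not_crosses ?_ ?_ ?_ h2) hz' hz
          · simpa
          · simpa using hd.1
          · simp [hab.symm, hac.symm, hd.2.2.symm, hd.2.1.symm]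
        · rw [Sym2.eq_swap] at hz
          exact hzc (D.edge_inter_of_adjacent hd.1.symm hac hd.2.2 ⟨hz, hz'⟩))
    rw [disjoint_left]
    intro z hz hzT
    refine disjoint_left.1 this ⟨hz, ?_⟩ hzT
    rintro rfl
    exact hTJ hzT (.inr (D.pt_left_mem hac))
  have hTC : T ⊆ Cᶜ := by
    intro z hz
    rw [hC]
    rintro (((hz' | hz') | hz') | hz')
    · exact hTJ hz (.inl (.inl hz'))
    · exact hTJ hz (.inl (.inr hz'))
    · exact disjoint_left.1 hcd hz' hz
    · exact disjoint_left.1 hda hz' hz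
  have hCc : IsClosed C := hC ▸ (((D.isCompact_edge hab).union (D.isCompact_edge hbc)).union
    (D.isCompact_edge hd.2.2.symm)).union (D.isCompact_edge hd.1) |>.isClosed
  obtain ⟨y, hyU, hyT⟩ := mem_closure_iff.1 (hJ (.inr hp)) _
    (hCc.isOpen_compl.connectedComponentIn (x := p)) (mem_connectedComponentIn hpC)
  rw [connectedComponentIn_eq hyU]
  exact isPreconnected_connectedComponentIn.subset_connectedComponentIn hyT hTC
    (mem_connectedComponentIn hwJ)

theorem cycle_four (v : Fin 4 → V) : D.cycle v = D.edge s(v 0, v 1) ∪ D.edge s(v 1, v 2) ∪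
    D.edge s(v 2, v 3) ∪ D.edge s(v 3, v 0) := by
  have e : ∀ i : Fin 4, cycleEdge v i = s(v i, v (i + 1)) := fun i => by
    simp [cycleEdge, finRotate_apply]
  ext z
  simp only [cycle, mem_iUnion, e, Fin.exists_fin_succ, mem_union]
  simp [or_assoc]

theorem not_isEmptyTriangulation (hD : D.CrossingMaximal)
    (h : ∀ a b c d : V, [a, b, c, d].Nodup → D.Crosses s(a, c) s(b, d) →
      D.OppositeSeparated a b c d) (v : Fin 4 → V) : ¬ D.IsEmptyTriangulation v := by
  rintro ⟨⟨-, hinj, hplane⟩, S, ⟨x, hx, hS⟩, hemp, F, hF, -, hSF⟩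
  have e : ∀ i : Fin 4, cycleEdge v i = s(v i, v (i + 1)) := fun i => by
    simp [cycleEdge, finRotate_apply]
  have n1 : ¬ D.Crosses s(v 0, v 1) s(v 2, v 3) := by simpa [e] using hplane 0 2
  have n2 : ¬ D.Crosses s(v 1, v 2) s(v 3, v 0) := by simpa [e] using hplane 1 3
  have hne : ∀ i j : Fin 4, i ≠ j → v i ≠ v j := fun i j hij e => hij (hinj e)
  have h01 := hne 0 1 (by decide)
  have h02 := hne 0 2 (by decide)
  have h03 := hne 0 3 (by decide)
  have h12 := hne 1 2 (by decide)
  have h13 := hne 1 3 (by decide)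
  have h23 := hne 2 3 (by decide)
  have hnd : [v 0, v 1, v 2, v 3].Nodup := by simp_all
  have hcr : D.Crosses s(v 0, v 2) s(v 1, v 3) := by
    rcases hD _ _ _ _ hnd with h | h | h
    · exact absurd h n1
    · exact h
    · exact absurd (Sym2.eq_swap (a := v 0) ▸ h.symm) n2
  obtain ⟨w, ⟨w0, w1, w2, w3⟩, hs⟩ := h _ _ _ _ hnd hcr
  obtain ⟨hedge, p, ⟨hp1, hp2⟩, hpt⟩ := hcr
  set C := D.cycle v with hCdef
  have hC := D.cycle_four v
  rw [← hCdef] at hC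
  have hCc : IsClosed C := hC ▸ ((((D.isCompact_edge h01).union (D.isCompact_edge h12)).union
    (D.isCompact_edge h23)).union (D.isCompact_edge h03.symm)).isClosed
  have hptC : ∀ u, D.pt u ∈ C → u ∈ range v := by
    intro u hu
    rw [hC] at hu
    have key : ∀ i j, v i ≠ v j → D.pt u ∈ D.edge s(v i, v j) → u ∈ range v := by
      intro i j hij hu
      rcases Sym2.mem_iff.1 (D.edge_vertex _ (by simpa) u hu) with h | h
      exacts [⟨i, h.symm⟩, ⟨j, h.symm⟩]
    rcases hu with ((hu | hu) | hu) | hu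
    exacts [key _ _ h01 hu, key _ _ h12 hu, key _ _ h23 hu, key _ _ h03.symm hu]
  have hpC : p ∉ C := by
    rw [hC]
    rintro (((hz | hz) | hz) | hz)
    · exact hpt ⟨_, (D.edge_inter_of_adjacent h01 h02 h12 ⟨hz, hp1⟩).symm⟩
    · exact hpt ⟨_, (D.edge_inter_of_adjacent h12 h13 h23 ⟨hz, hp2⟩).symm⟩
    · rw [Sym2.eq_swap] at hp1
      exact hpt ⟨_, (D.edge_inter_of_adjacent h23 h02.symm h03.symm ⟨hz, hp1⟩).symm⟩
    · rw [Sym2.eq_swap] at hp2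
      exact hpt ⟨_, (D.edge_inter_of_adjacent h03.symm h13.symm h01 ⟨hz, hp2⟩).symm⟩
  set U := connectedComponentIn Cᶜ x with hU
  have hUo : IsOpen U := hCc.isOpen_compl.connectedComponentIn
  have hUS : U ⊆ interior S := by
    rw [hS]
    exact interior_maximal subset_closure hUo
  have hclU : ∀ z ∈ S, z ∉ C → z ∈ U := by
    intro z hz hzC
    rw [hS] at hz
    obtain ⟨y, hy, hyU⟩ := mem_closure_iff.1 hz _
      (hCc.isOpen_compl.connectedComponentIn (x := z)) (mem_connectedComponentIn hzC)
    rw [hU, connectedComponentIn_eq hyU, ← connectedComponentIn_eq hy]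
    exact mem_connectedComponentIn hzC
  by_cases hpU : p ∈ U
  · -- the side contains the diagonals, and therefore the vertex `w`
    have hwU : D.pt w ∈ U := by
      rw [hU, connectedComponentIn_eq hpU]
      have n1' : ¬ D.Crosses s(v 2, v 3) s(v 0, v 1) := fun h => n1 h.symm
      have n2' : ¬ D.Crosses s(v 3, v 0) s(v 1, v 2) := fun h => n2 h.symm
      rcases hs with hs | hs | hs | hs
      · exact D.pt_mem_component_of_separates h01 h12 h02 ⟨h03.symm, h13.symm, h23.symm⟩
          ⟨w0, w1, w2⟩ hs n1 n2 hC hp1 hpC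
      · refine D.pt_mem_component_of_separates h12 h23 h13 ⟨h01, h02, h03⟩ ⟨w1, w2, w3⟩ hs n2 n1'
          ?_ hp2 hpC
        rw [hC]; ext z; simp only [mem_union]; tauto
      · refine D.pt_mem_component_of_separates h23 h03.symm h02.symm ⟨h12, h13, h01.symm⟩
          ⟨w2, w3, w0⟩ hs n1' n2' ?_ (Sym2.eq_swap (a := v 0) ▸ hp1) hpC
        rw [hC]; ext z; simp only [mem_union]; tauto
      · refine D.pt_mem_component_of_separates h03.symm h01 h13.symm ⟨h23, h02.symm, h12.symm⟩
          ⟨w3, w0, w1⟩ hs n2' n1 ?_ (Sym2.eq_swap (a := v 1) ▸ hp2) hpC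
        rw [hC]; ext z; simp only [mem_union]; tauto
    exact hemp w (hUS hwU)
  · -- the side contains no diagonal, but every triangle on vertices of the cycle contains one
    have hxS : x ∈ ⋃₀ F := hSF ▸ interior_subset (hUS (mem_connectedComponentIn hx))
    obtain ⟨T, hTF, -⟩ := hxS
    obtain ⟨a, b, c, hab, hbc, hac, ⟨y, hy, hT⟩, -⟩ := hF T hTF
    have hTS : T ⊆ S := hSF ▸ subset_sUnion_of_mem hTF
    obtain ⟨u, hu⟩ : ∃ u, u ≠ a ∧ u ≠ b ∧ u ≠ c := by
      classical
      by_contra! hcon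
      have hle := Finset.card_le_card (s := Finset.univ.image v) (t := {a, b, c}) fun u _ => by
        simpa [or_iff_not_imp_left] using hcon u
      rw [Finset.card_image_of_injective _ hinj, Finset.card_fin] at hle
      exact absurd (hle.trans Finset.card_le_three) (by norm_num)
    have hJT : D.triangle a b c ⊆ T := by
      obtain ⟨z, hz, z', hz', hzz⟩ := hD.exists_component_ne hab hbc hac hu
      rw [hT]
      by_cases hyz : connectedComponentIn (D.triangle a b c)ᶜ y =
          connectedComponentIn (D.triangle a b c)ᶜ z
      · exact D.triangle_subset_closure hab hbc hac hy hz' (hyz ▸ hzz)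
      · exact D.triangle_subset_closure hab hbc hac hy hz hyz
    have hv : ∀ u, D.pt u ∈ D.triangle a b c → u ∈ range v := fun u hu => hptC u <| by
      by_contra hn
      exact hemp u (hUS (hclU _ (hTS (hJT hu)) hn))
    have hE1 : D.edge s(a, b) ⊆ S := fun z hz => hTS (hJT (.inl (.inl hz)))
    have hE2 : D.edge s(b, c) ⊆ S := fun z hz => hTS (hJT (.inl (.inr hz)))
    have hE3 : D.edge s(a, c) ⊆ S := fun z hz => hTS (hJT (.inr hz))
    have hpS : p ∉ S := fun h => hpU (hclU p h hpC)
    obtain ⟨i, rfl⟩ := hv a (.inr (D.pt_left_mem hac))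
    obtain ⟨j, rfl⟩ := hv b (.inl (.inl (D.pt_right_mem hab)))
    obtain ⟨k, rfl⟩ := hv c (.inr (D.pt_right_mem hac))
    have key : ∀ i j : Fin 4, D.edge s(v i, v j) ⊆ S → j ≠ i + 2 := by
      intro i j hij hji
      subst hji
      refine hpS (hij ?_)
      fin_cases i
      · exact hp1
      · exact hp2
      · exact Sym2.eq_swap (a := v 0) ▸ hp1
      · exact Sym2.eq_swap (a := v 1) ▸ hp2
    have hij := key i j hE1
    have hjk := key j k hE2
    have hik := key i k hE3
    have hij' : i ≠ j := fun e => hab (congrArg v e)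
    have hjk' : j ≠ k := fun e => hbc (congrArg v e)
    have hik' : i ≠ k := fun e => hac (congrArg v e)
    clear * - hij hjk hik hij' hjk' hik'
    revert i j k
    decide

end SimpleDrawing

/-! ### The crossing pairs of the modified twisted drawing -/

/-- The unordered crossing relation of the modified twisted drawing. -/
def ModifiedTwistedCross (n : ℕ) (e f : Sym2 ℕ) : Prop :=
  ModifiedTwistedPair n e f ∨ ModifiedTwistedPair n f e

/-- The crossing pairs of edges `il` and `jk`, where `i < l` and `j < k`, as an explicit
arithmetical condition. -/
def CrossingIndices (n i l j k : ℕ) : Prop :=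
  (1 ≤ i ∧ i < j ∧ j < k ∧ k < l ∧ l ≤ n ∧ i ≠ 2 ∧ j ≠ 2 ∧ k ≠ 2 ∧ l ≠ 2) ∨
  (i = 1 ∧ l = 2 ∧ ((j = 3 ∧ (k = n ∨ k = 4)) ∨ (j = 4 ∧ 5 ≤ k ∧ k ≤ n))) ∨
  (i = 2 ∧ l = 4 ∧ j = 3 ∧ k = n) ∨
  (i = 2 ∧ 5 ≤ l ∧ l < n ∧ ((j = 1 ∧ k = 3) ∨ (j = 3 ∧ k = n) ∨ (j = 1 ∧ l < k ∧ k ≤ n) ∨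
    (2 < j ∧ j < k ∧ k < l))) ∨
  (i = 2 ∧ l = n ∧ 3 < j ∧ j < k ∧ k < n)

theorem modifiedTwistedPair_iff {n i l j k : ℕ} (hil : i < l) (hjk : j < k) (hn : 6 ≤ n) :
    ModifiedTwistedPair n s(i, l) s(j, k) ↔ CrossingIndices n i l j k := by
  constructor
  · intro h
    generalize he : s(i, l) = e at h
    generalize hf : s(j, k) = f at h
    cases h <;> rw [Sym2.eq_iff] at he hf <;>
      rcases he with ⟨rfl, rfl⟩ | ⟨rfl, rfl⟩ <;> rcases hf with ⟨rfl, rfl⟩ | ⟨rfl, rfl⟩ <;>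
      first
      | (exfalso; omega)
      | simp_all [CrossingIndices]
  · rintro (⟨h1, hij, hjk, hkl, hl, h⟩ | ⟨rfl, rfl, ⟨rfl, rfl | rfl⟩ | ⟨rfl, h5, hk⟩⟩ |
      ⟨rfl, rfl, rfl, rfl⟩ | ⟨rfl, h5, hl, ⟨rfl, rfl⟩ | ⟨rfl, rfl⟩ | ⟨rfl, h, h'⟩ | ⟨h, h', h''⟩⟩ |
      ⟨rfl, rfl, h, h', h''⟩)
    · exact .twisted i j k l h1 hij hjk hkl hl h.1 h.2.1 h.2.2.1 h.2.2.2
    · exact .one_a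
    · exact .one_b
    · exact .one_c k h5 hk
    · exact .four
    · exact .mid_a l h5 hl
    · exact .mid_b l h5 hl
    · exact .mid_c l k h5 hl h h'
    · exact .mid_d l j k h5 hl h h' h''
    · exact .last j k h h' h''

theorem modifiedTwistedCross_iff {n i l j k : ℕ} (hil : i < l) (hjk : j < k) (hn : 6 ≤ n) :
    ModifiedTwistedCross n s(i, l) s(j, k) ↔
      CrossingIndices n i l j k ∨ CrossingIndices n j k i l :=
  or_congr (modifiedTwistedPair_iff hil hjk hn) (modifiedTwistedPair_iff hjk hil hn)

theorem modifiedTwistedCross_sort {n a b c d : ℕ} (hab : a ≠ b) (hcd : c ≠ d) (hn : 6 ≤ n) :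
    ModifiedTwistedCross n s(a, b) s(c, d) ↔
      CrossingIndices n (min a b) (max a b) (min c d) (max c d) ∨
      CrossingIndices n (min c d) (max c d) (min a b) (max a b) := by
  rw [← modifiedTwistedCross_iff (by omega) (by omega) hn]
  have key : ∀ x y : ℕ, s(x, y) = s(min x y, max x y) := fun x y => by
    rcases le_total x y with h | h
    · rw [min_eq_left h, max_eq_right h]
    · rw [min_eq_right h, max_eq_left h, Sym2.eq_swap]
  rw [key a b, key c d]

theorem ModifiedTwistedCross.symm {n : ℕ} {e f : Sym2 ℕ} (h : ModifiedTwistedCross n e f) :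
    ModifiedTwistedCross n f e :=
  Or.symm h

/-- Some label `w` outside `e` and `f` and some label `t` of the four labels `t, x, y, z` of
`e` and `f` are joined by an edge that crosses exactly one edge of the triangle `xyz`. -/
def HasWitness (n : ℕ) (e f : Sym2 ℕ) : Prop :=
  ∃ w t x y z : ℕ, [t, x, y, z].Nodup ∧ (∀ v, v ∈ e ∨ v ∈ f ↔ v = t ∨ v = x ∨ v = y ∨ v = z) ∧
    (w ∉ e ∧ w ∉ f) ∧ (1 ≤ w ∧ w ≤ n) ∧ ModifiedTwistedCross n s(y, z) s(w, t) ∧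
    ¬ ModifiedTwistedCross n s(x, y) s(w, t) ∧ ¬ ModifiedTwistedCross n s(x, z) s(w, t)

/-- Each prescribed crossing has a witness. The choice of `w` depends on the kind of the crossing and
changes in extreme cases, such as `l = n`, where the label used otherwise is not available. -/
theorem ModifiedTwistedPair.hasWitness {n : ℕ} (hn : 6 ≤ n) {e f : Sym2 ℕ}
    (h : ModifiedTwistedPair n e f) : HasWitness n e f := by
  -- the witness together with the reductions common to all cases
  have key : ∀ {a b c d : ℕ} (w t x y z : ℕ), [t, x, y, z].Nodup →
      (∀ v, (v = a ∨ v = b) ∨ v = c ∨ v = d ↔ v = t ∨ v = x ∨ v = y ∨ v = z) →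
      (w ≠ a ∧ w ≠ b ∧ w ≠ c ∧ w ≠ d) → (1 ≤ w ∧ w ≤ n) →
      ModifiedTwistedCross n s(y, z) s(w, t) →
      ¬ (CrossingIndices n (min x y) (max x y) (min w t) (max w t) ∨
        CrossingIndices n (min w t) (max w t) (min x y) (max x y)) →
      ¬ (CrossingIndices n (min x z) (max x z) (min w t) (max w t) ∨
        CrossingIndices n (min w t) (max w t) (min x z) (max x z)) →
      HasWitness n s(a, b) s(c, d) := by
    intro a b c d w t x y z hnd hv hw hwn h1 h2 h3
    have hwt : w ≠ t := by
      rintro rfl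
      have := (hv w).2 (.inl rfl)
      omega
    simp only [List.nodup_cons, List.mem_cons, List.not_mem_nil, or_false, not_or] at hnd
    refine ⟨w, t, x, y, z, by simpa using hnd, by simpa using hv,
      by simpa [and_assoc] using hw, hwn, h1, ?_, ?_⟩
    · rwa [modifiedTwistedCross_sort (by omega) hwt hn]
    · rwa [modifiedTwistedCross_sort (by omega) hwt hn]
  cases h with
  | twisted i j k l h1 hij hjk hkl hl hi2 hj2 hk2 hl2 =>
    by_cases hln : l < n
    · exact key n j i k l (by simp; omega) (by omega) (by omega) (by omega)
        (Sym2.eq_swap (a := j) ▸ .inr (.twisted j k l n (by omega) hjk hkl hln le_rfl hj2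
          hk2 hl2 (by omega)))
        (by unfold CrossingIndices; omega) (by unfold CrossingIndices; omega)
    obtain rfl : l = n := by omega
    by_cases hi3 : 3 ≤ i
    · exact key 1 k l i j (by simp; omega) (by omega) (by omega) (by omega)
        (.inr (.twisted 1 i j k le_rfl (by omega) hij hjk (by omega) (by omega) hi2 hj2 hk2))
        (by unfold CrossingIndices; omega) (by unfold CrossingIndices; omega)
    obtain rfl : i = 1 := by omega
    by_cases hj4 : 4 ≤ j
    · exact key 3 k j 1 l (by simp; omega) (by omega) (by omega) (by omega)
        (.inl (.twisted 1 3 k l le_rfl (by omega) (by omega) hkl hl hi2 (by omega) hk2 hl2))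
        (by unfold CrossingIndices; omega) (by unfold CrossingIndices; omega)
    obtain rfl : j = 3 := by omega
    by_cases hk5 : 5 ≤ k
    · exact key 2 1 k 3 l (by simp; omega) (by omega) (by omega) (by omega)
        (Sym2.eq_swap (a := 1) ▸ .inr .one_a)
        (by unfold CrossingIndices; omega) (by unfold CrossingIndices; omega)
    obtain rfl : k = 4 := by omega
    exact key 2 4 1 3 l (by simp; omega) (by omega) (by omega) (by omega)
      (.inr .four)
      (by unfold CrossingIndices; omega) (by unfold CrossingIndices; omega)
  | one_a =>
    exact key 4 2 1 3 n (by simp; omega) (by omega) (by omega) (by omega)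
      (Sym2.eq_swap (a := 2) ▸ .inr .four)
      (by unfold CrossingIndices; omega) (by unfold CrossingIndices; omega)
  | one_b =>
    exact key 5 1 2 3 4 (by simp) (by omega) (by omega) (by omega)
      (Sym2.eq_swap (a := 1) ▸ .inr (.twisted 1 3 4 5
        (by omega) (by omega) (by omega) (by omega) (by omega)
        (by omega) (by omega) (by omega) (by omega)))
      (by unfold CrossingIndices; omega) (by unfold CrossingIndices; omega)
  | one_c i hi hin =>
    by_cases hin' : i < n
    · exact key n 4 i 1 2 (by simp; omega) (by omega) (by omega) (by omega)
        (Sym2.eq_swap (a := 4) ▸ .inl (.one_c n (by omega) (by omega)))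
        (by unfold CrossingIndices; omega) (by unfold CrossingIndices; omega)
    obtain rfl : i = n := by omega
    exact key 5 2 4 1 i (by simp; omega) (by omega) (by omega) (by omega)
      (Sym2.eq_swap (a := 2) ▸ .inr (.mid_c 5 i (by omega) (by omega) (by omega) (by omega)))
      (by unfold CrossingIndices; omega) (by unfold CrossingIndices; omega)
  | four =>
    exact key 1 n 2 3 4 (by simp; omega) (by omega) (by omega) (by omega)
      (.inr (.twisted 1 3 4 n (by omega) (by omega) (by omega) (by omega) (by omega)
        (by omega) (by omega) (by omega) (by omega)))
      (by unfold CrossingIndices; omega) (by unfold CrossingIndices; omega)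
  | mid_a j hj hjn =>
    exact key 4 j 3 1 2 (by simp; omega) (by omega) (by omega) (by omega)
      (.inl (.one_c j hj (by omega)))
      (by unfold CrossingIndices; omega) (by unfold CrossingIndices; omega)
  | mid_b j hj hjn =>
    exact key 1 2 j 3 n (by simp; omega) (by omega) (by omega) (by omega)
      (.inr .one_a)
      (by unfold CrossingIndices; omega) (by unfold CrossingIndices; omega)
  | mid_c j k hj hjn hjk hk =>
    by_cases hkn : k < n
    · exact key n 2 1 j k (by simp; omega) (by omega) (by omega) (by omega)
        (Sym2.eq_swap (a := 2) ▸ .inr (.last j k (by omega) hjk hkn))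
        (by unfold CrossingIndices; omega) (by unfold CrossingIndices; omega)
    obtain rfl : k = n := by omega
    exact key 4 k j 1 2 (by simp; omega) (by omega) (by omega) (by omega)
      (.inl (.one_c k (by omega) (by omega)))
      (by unfold CrossingIndices; omega) (by unfold CrossingIndices; omega)
  | mid_d j i k hj hjn hi hik hkj =>
    by_cases hi4 : 4 ≤ i
    · exact key n i 2 k j (by simp; omega) (by omega) (by omega) (by omega)
        (Sym2.eq_swap (a := i) ▸ .inr (.twisted i k j n
          (by omega) hik hkj hjn le_rfl (by omega) (by omega) (by omega) (by omega)))
        (by unfold CrossingIndices; omega) (by unfold CrossingIndices; omega)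
    obtain rfl : i = 3 := by omega
    exact key n 2 3 k j (by simp; omega) (by omega) (by omega) (by omega)
      (Sym2.eq_swap (a := 2) ▸ .inr (.last k j (by omega) hkj hjn))
      (by unfold CrossingIndices; omega) (by unfold CrossingIndices; omega)
  | last i j hi hij hjn =>
    exact key 3 i n 2 j (by simp; omega) (by omega) (by omega) (by omega)
      (.inl (.mid_d j 3 i (by omega) hjn (by omega) hi hij))
      (by unfold CrossingIndices; omega) (by unfold CrossingIndices; omega)

theorem exists_modifiedTwistedCross_of_lt {n i j k l : ℕ} (hi : 1 ≤ i) (hij : i < j) (hjk : j < k)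
    (hkl : k < l) (hl : l ≤ n) : ModifiedTwistedCross n s(i, j) s(k, l) ∨
      ModifiedTwistedCross n s(i, k) s(j, l) ∨ ModifiedTwistedCross n s(i, l) s(j, k) := by
  by_cases h2i : i = 2
  · subst h2i
    by_cases hln : l < n
    · exact .inr (.inr (.inl (.mid_d l j k (by omega) hln hij hjk hkl)))
    obtain rfl : l = n := by omega
    by_cases hj3 : j = 3
    · subst hj3
      by_cases hk4 : k = 4
      · subst hk4
        exact .inr (.inl (.inl .four))
      · exact .inr (.inl (.inl (.mid_b k (by omega) hkl)))
    · exact .inr (.inr (.inl (.last j k (by omega) hjk hkl)))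
  by_cases h2j : j = 2
  · subst h2j
    obtain rfl : i = 1 := by omega
    by_cases hk5 : 5 ≤ k
    · exact .inr (.inr (.inr (.mid_c k l hk5 (by omega) hkl hl)))
    by_cases hk4 : k = 4
    · subst hk4
      exact .inl (.inl (.one_c l (by omega) hl))
    obtain rfl : k = 3 := by omega
    by_cases hl4 : l = 4
    · subst hl4
      exact .inl (.inl .one_b)
    by_cases hln : l = n
    · subst hln
      exact .inl (.inl .one_a)
    · exact .inr (.inl (.inr (.mid_a l (by omega) (by omega))))
  · exact .inr (.inr (.inl (.twisted i j k l hi hij hjk hkl hl h2i h2j (by omega) (by omega))))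

theorem exists_modifiedTwistedCross {n a b c d : ℕ} (hnd : [a, b, c, d].Nodup)
    (ha : 1 ≤ a ∧ a ≤ n) (hb : 1 ≤ b ∧ b ≤ n) (hc : 1 ≤ c ∧ c ≤ n) (hd : 1 ≤ d ∧ d ≤ n) :
    ModifiedTwistedCross n s(a, b) s(c, d) ∨ ModifiedTwistedCross n s(a, c) s(b, d) ∨
      ModifiedTwistedCross n s(a, d) s(b, c) := by
  set M : ℕ → ℕ → ℕ → ℕ → Prop := fun a b c d => ModifiedTwistedCross n s(a, b) s(c, d) ∨
    ModifiedTwistedCross n s(a, c) s(b, d) ∨ ModifiedTwistedCross n s(a, d) s(b, c) with hM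
  have s1 : ∀ a b c d, M a b c d → M b a c d := by
    rintro a b c d (h | h | h)
    · exact .inl (Sym2.eq_swap (a := a) ▸ h)
    · exact .inr (.inr h.symm)
    · exact .inr (.inl h.symm)
  have s2 : ∀ a b c d, M a b c d → M a c b d := by
    rintro a b c d (h | h | h)
    · exact .inr (.inl h)
    · exact .inl h
    · exact .inr (.inr (Sym2.eq_swap (a := b) ▸ h))
  have s3 : ∀ a b c d, M a b c d → M a b d c := by
    rintro a b c d (h | h | h)
    · exact .inl (Sym2.eq_swap (a := c) ▸ h)
    · exact .inr (.inr h)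
    · exact .inr (.inl h)
  have base : ∀ a b c d, 1 ≤ a → a < b → b < c → c < d → d ≤ n → M a b c d :=
    fun a b c d h1 h2 h3 h4 h5 => exists_modifiedTwistedCross_of_lt h1 h2 h3 h4 h5
  change M a b c d
  clear_value M
  simp only [List.nodup_cons, List.mem_cons, List.not_mem_nil, or_false, not_or] at hnd
  -- insertion sort
  have h3 : ∀ a b c d, [a, b, c, d].Nodup → 1 ≤ a ∧ a ≤ n → 1 ≤ b → d ≤ n → b < c → c < d →
      M a b c d := by
    intro a b c d hnd ha hb hd hbc hcd
    simp only [List.nodup_cons, List.mem_cons, List.not_mem_nil, or_false, not_or] at hnd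
    rcases lt_or_ge a b with h | h
    · exact base a b c d ha.1 h hbc hcd hd
    rcases lt_or_ge a c with h | h
    · exact s1 _ _ _ _ (base b a c d hb (by omega) h hcd hd)
    rcases lt_or_ge a d with h | h
    · exact s1 _ _ _ _ (s2 _ _ _ _ (base b c a d hb hbc (by omega) h hd))
    · exact s1 _ _ _ _ (s2 _ _ _ _ (s3 _ _ _ _ (base b c d a hb hbc hcd (by omega) ha.2)))
  have h2 : ∀ a b c d, [a, b, c, d].Nodup → 1 ≤ a ∧ a ≤ n → 1 ≤ b ∧ b ≤ n → 1 ≤ c → d ≤ n →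
      c < d → M a b c d := by
    intro a b c d hnd ha hb hc hd hcd
    simp only [List.nodup_cons, List.mem_cons, List.not_mem_nil, or_false, not_or] at hnd
    rcases lt_or_ge b c with h | h
    · exact h3 a b c d (by simp; omega) ha hb.1 hd h hcd
    rcases lt_or_ge b d with h | h
    · exact s2 _ _ _ _ (h3 a c b d (by simp; omega) ha hc hd (by omega) h)
    · exact s2 _ _ _ _ (s3 _ _ _ _ (h3 a c d b (by simp; omega) ha hc hb.2 hcd (by omega)))
  rcases lt_or_ge c d with h | h
  · exact h2 a b c d (by simp; omega) ha hb hc.1 hd.2 h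
  · exact s3 _ _ _ _ (h2 a b d c (by simp; omega) ha hb hd.1 hc.2 (by omega))

namespace SimpleDrawing

/-- Triangles on the same three vertices are equal. -/
theorem triangle_congr {V : Type*} (D : SimpleDrawing V) {a b c x y z : V} (hab : a ≠ b)
    (hbc : b ≠ c) (hac : a ≠ c) (hxy : x ≠ y) (hyz : y ≠ z) (hxz : x ≠ z)
    (h : ∀ v, v = a ∨ v = b ∨ v = c ↔ v = x ∨ v = y ∨ v = z) :
    D.triangle a b c = D.triangle x y z := by
  have key : ∀ {a b c : V}, a ≠ b → b ≠ c → a ≠ c → D.triangle a b c = ⋃ (u : V) (v : V)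
      (_ : (u = a ∨ u = b ∨ u = c) ∧ (v = a ∨ v = b ∨ v = c) ∧ u ≠ v), D.edge s(u, v) := by
    intro a b c hab hbc hac
    refine subset_antisymm ?_ ?_
    · rintro p ((hp | hp) | hp)
      · exact mem_iUnion₂.2 ⟨a, b, mem_iUnion.2 ⟨by simp [hab], hp⟩⟩
      · exact mem_iUnion₂.2 ⟨b, c, mem_iUnion.2 ⟨by simp [hbc], hp⟩⟩
      · exact mem_iUnion₂.2 ⟨a, c, mem_iUnion.2 ⟨by simp [hac], hp⟩⟩
    · intro p hp
      simp only [mem_iUnion] at hp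
      obtain ⟨u, v, ⟨rfl | rfl | rfl, rfl | rfl | rfl, huv⟩, hp⟩ := hp
      all_goals first
        | exact absurd rfl huv
        | exact .inl (.inl hp)
        | exact .inl (.inr hp)
        | exact .inr hp
        | exact .inl (.inl (Sym2.eq_swap ▸ hp))
        | exact .inl (.inr (Sym2.eq_swap ▸ hp))
        | exact .inr (Sym2.eq_swap ▸ hp)
  rw [key hab hbc hac, key hxy hyz hxz]
  simp only [h]

theorem crossingMaximal_of_crosses_iff {n : ℕ} {D : SimpleDrawing (Fin n)}
    (σ : Equiv.Perm (Fin n)) (hσ : ∀ e f : Sym2 (Fin n), ¬ e.IsDiag → ¬ f.IsDiag →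
      (D.Crosses e f ↔ ModifiedTwistedCross n (e.map fun v => (σ v : ℕ) + 1)
        (f.map fun v => (σ v : ℕ) + 1))) : D.CrossingMaximal := by
  intro a b c d hnd
  have hl : ∀ u v, (σ u : ℕ) + 1 = (σ v : ℕ) + 1 → u = v := fun u v h =>
    σ.injective (Fin.ext (Nat.succ_injective h))
  have hb : ∀ u, 1 ≤ (σ u : ℕ) + 1 ∧ (σ u : ℕ) + 1 ≤ n := fun u => ⟨by omega, (σ u).2⟩
  have hnd' := hnd.map (f := fun v => (σ v : ℕ) + 1) hl
  simp only [List.nodup_cons, List.mem_cons, List.not_mem_nil, or_false, not_or] at hnd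
  rw [hσ _ _ (by simp; tauto) (by simp; tauto), hσ _ _ (by simp; tauto) (by simp; tauto),
    hσ _ _ (by simp; tauto) (by simp; tauto)]
  exact exists_modifiedTwistedCross hnd' (hb a) (hb b) (hb c) (hb d)

theorem triple_iff_of_quadruple_iff {α : Type*} {a b c d t x y z : α} (hab : a ≠ b) (hac : a ≠ c)
    (had : a ≠ d) (hbc : b ≠ c) (hbd : b ≠ d) (hcd : c ≠ d) (htx : t ≠ x) (hty : t ≠ y)
    (htz : t ≠ z)
    (h : ∀ v, (v = a ∨ v = c) ∨ v = b ∨ v = d ↔ v = t ∨ v = x ∨ v = y ∨ v = z) :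
    (t = a → ∀ v, v = b ∨ v = c ∨ v = d ↔ v = x ∨ v = y ∨ v = z) ∧
    (t = c → ∀ v, v = d ∨ v = a ∨ v = b ↔ v = x ∨ v = y ∨ v = z) ∧
    (t = b → ∀ v, v = c ∨ v = d ∨ v = a ↔ v = x ∨ v = y ∨ v = z) ∧
    (t = d → ∀ v, v = a ∨ v = b ∨ v = c ↔ v = x ∨ v = y ∨ v = z) := by
  refine ⟨?_, ?_, ?_, ?_⟩ <;> rintro rfl v <;> by_cases hv : v = t
  all_goals first
    | (subst hv; simp [*, Ne.symm hab, Ne.symm hac, Ne.symm had, Ne.symm hbc, Ne.symm hbd,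
        Ne.symm hcd])
    | simpa [hv] using h v
    | (have := h v; simp only [hv, false_or, or_false] at this; rw [← this]; tauto)

theorem oppositeSeparated_of_crosses_iff {n : ℕ} (hn : 6 ≤ n) {D : SimpleDrawing (Fin n)}
    (σ : Equiv.Perm (Fin n)) (hσ : ∀ e f : Sym2 (Fin n), ¬ e.IsDiag → ¬ f.IsDiag →
      (D.Crosses e f ↔ ModifiedTwistedCross n (e.map fun v => (σ v : ℕ) + 1)
        (f.map fun v => (σ v : ℕ) + 1)))
    (a b c d : Fin n) (hnd : [a, b, c, d].Nodup)
    (hcr : D.Crosses s(a, c) s(b, d)) : D.OppositeSeparated a b c d := by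
  set l : Fin n → ℕ := fun v => (σ v : ℕ) + 1 with hl
  have hli : Function.Injective l := fun u v h => σ.injective (Fin.ext (Nat.succ_injective h))
  have hX : ∀ u v x y, u ≠ v → x ≠ y → (D.Crosses s(u, v) s(x, y) ↔
      ModifiedTwistedCross n s(l u, l v) s(l x, l y)) := fun u v x y h h' =>
    hσ s(u, v) s(x, y) (by simpa) (by simpa)
  simp only [List.nodup_cons, List.mem_cons, List.not_mem_nil, or_false, not_or] at hnd
  have hwit : HasWitness n s(l a, l c) s(l b, l d) := by
    rcases (hX a c b d hnd.1.2.1 hnd.2.1.2).1 hcr with h | h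
    · exact h.hasWitness hn
    · obtain ⟨w, t, x, y, z, h1, h2, h3, h4⟩ := h.hasWitness hn
      exact ⟨w, t, x, y, z, h1, fun v => or_comm.trans (h2 v), h3.symm, h4⟩
  obtain ⟨w, t, x, y, z, hnd', hv, hw, hwn, h1, h2, h3⟩ := hwit
  have hlift : ∀ u, (u = t ∨ u = x ∨ u = y ∨ u = z) → ∃ u', l u' = u := by
    intro u hu
    have := (hv u).2 hu
    simp only [Sym2.mem_iff] at this
    rcases this with (h | h) | h | h
    exacts [⟨a, h.symm⟩, ⟨c, h.symm⟩, ⟨b, h.symm⟩, ⟨d, h.symm⟩]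
  obtain ⟨t, rfl⟩ := hlift t (by simp)
  obtain ⟨x, rfl⟩ := hlift x (by simp)
  obtain ⟨y, rfl⟩ := hlift y (by simp)
  obtain ⟨z, rfl⟩ := hlift z (by simp)
  obtain ⟨w, rfl⟩ : ∃ w', l w' = w :=
    ⟨σ.symm ⟨w - 1, by omega⟩, by simp only [hl, Equiv.apply_symm_apply]; omega⟩
  have hv' : ∀ v, (v = a ∨ v = c) ∨ v = b ∨ v = d ↔ v = t ∨ v = x ∨ v = y ∨ v = z := by
    intro v
    simpa [hli.eq_iff] using hv (l v)
  simp only [Sym2.mem_iff, hli.eq_iff, not_or] at hw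
  simp only [List.nodup_cons, List.mem_cons, List.not_mem_nil, or_false, not_or,
    hli.eq_iff] at hnd'
  obtain ⟨⟨htx, hty, htz⟩, ⟨hxy, hxz⟩, hyz, -⟩ := hnd'
  have hwv : ∀ v, (v = t ∨ v = x ∨ v = y ∨ v = z) → w ≠ v := by
    rintro v hv rfl
    have := (hv' w).2 hv
    tauto
  have hwt := hwv t (by simp)
  have hsep : D.Separates x y z w t := by
    refine CrossesOnce.separates hxy hyz hxz hwt
      ⟨hwv x (by simp), hwv y (by simp), hwv z (by simp)⟩ ⟨htx, hty, htz⟩ ⟨?_, ?_, ?_⟩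
    · exact (hX _ _ _ _ hyz hwt).2 h1
    · exact fun h => h2 ((hX _ _ _ _ hxy hwt).1 h)
    · exact fun h => h3 ((hX _ _ _ _ hxz hwt).1 h)
  have hcongr : ∀ {a b c : Fin n}, a ≠ b → b ≠ c → a ≠ c →
      (∀ v, v = a ∨ v = b ∨ v = c ↔ v = x ∨ v = y ∨ v = z) → D.Separates a b c w t := by
    intro a b c hab hbc hac h
    rw [Separates, D.triangle_congr hab hbc hac hxy hyz hxz h]
    exact hsep
  refine ⟨w, ⟨hw.1.1, hw.2.1, hw.1.2, hw.2.2⟩, ?_⟩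
  obtain ⟨⟨hab, hac, had⟩, ⟨hbc, hbd⟩, hcd, -⟩ := hnd
  have htri := triple_iff_of_quadruple_iff hab hac had hbc hbd hcd htx hty htz hv'
  rcases (hv' t).2 (.inl rfl) with (h | h) | h | h
  · exact .inr (.inl (h ▸ hcongr hbc hcd hbd (htri.1 h)))
  · exact .inr (.inr (.inr (h ▸ hcongr (Ne.symm had) hab (Ne.symm hbd) (htri.2.1 h))))
  · exact .inr (.inr (.inl (h ▸ hcongr hcd (Ne.symm had) (Ne.symm hac) (htri.2.2.1 h))))
  · exact .inl (h ▸ hcongr hab hbc hac (htri.2.2.2 h))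

end SimpleDrawing

/-! ### Folded chords of a parabola -/

/-- Folding the region above the parabola `y = x ^ 2` onto the plane: the point `(x, y)` is written
as `(re z, |z| ^ 2)` with `z` in the closed upper half plane and is sent to `z ^ 2`. The points
`(a, a ^ 2)` and `(-a, a ^ 2)` of the parabola are identified. -/
noncomputable def parabolaFold (p : ℂ) : ℂ :=
  (p.re + Real.sqrt (p.im - p.re ^ 2) * Complex.I) ^ 2

theorem continuous_parabolaFold : Continuous parabolaFold := by
  unfold parabolaFold
  fun_prop

theorem continuous_mk {X : Type*} [TopologicalSpace X] {f g : X → ℝ} (hf : Continuous f)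
    (hg : Continuous g) : Continuous fun x => (⟨f x, g x⟩ : ℂ) := by
  have : (fun x => (⟨f x, g x⟩ : ℂ)) = fun x => (f x : ℂ) + g x * Complex.I :=
    funext fun x => by apply Complex.ext <;> simp
  rw [this]
  fun_prop

/-- The inverse of `parabolaFold`, defined outside the nonnegative real axis. -/
noncomputable def parabolaUnfold (w : ℂ) : ℂ :=
  ⟨-((-w) ^ (2⁻¹ : ℂ)).im, ‖w‖⟩

theorem parabolaUnfold_spec {w : ℂ} (hw : -w ∈ Complex.slitPlane) :
    ((parabolaUnfold w).re ^ 2 < (parabolaUnfold w).im) ∧ parabolaFold (parabolaUnfold w) = w := by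
  have h0 : -w ≠ 0 := Complex.slitPlane_ne_zero hw
  set r : ℂ := (-w) ^ (2⁻¹ : ℂ) with hr
  have hr2 : r ^ 2 = -w := by
    rw [hr]
    exact_mod_cast Complex.cpow_nat_inv_pow (-w) (n := 2) two_ne_zero
  have hre : 0 < r.re := by
    have harg := Complex.mem_slitPlane_iff_arg.1 hw
    rw [hr, Complex.cpow_def_of_ne_zero h0, Complex.exp_re]
    refine mul_pos (Real.exp_pos _) (Real.cos_pos_of_mem_Ioo ?_)
    have h1 := Complex.neg_pi_lt_arg (-w)
    have h2 := lt_of_le_of_ne (Complex.arg_le_pi (-w)) harg.1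
    have : (Complex.log (-w) * 2⁻¹).im = (-w).arg / 2 := by
      rw [show (2⁻¹ : ℂ) = ((2⁻¹ : ℝ) : ℂ) by simp, Complex.im_mul_ofReal, Complex.log_im]
      ring
    rw [this]
    constructor <;> linarith
  have hn : ‖w‖ = r.re ^ 2 + r.im ^ 2 := by
    rw [← norm_neg, ← hr2, norm_pow, Complex.sq_norm, Complex.normSq_apply]
    ring
  constructor
  · change (-r.im) ^ 2 < ‖w‖
    rw [hn]
    nlinarith
  · change ((((-r.im : ℝ) : ℂ) + Real.sqrt (‖w‖ - (-r.im) ^ 2) * Complex.I)) ^ 2 = w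
    have : ‖w‖ - (-r.im) ^ 2 = r.re ^ 2 := by rw [hn]; ring
    rw [this, Real.sqrt_sq hre.le]
    have e : (((-r.im : ℝ) : ℂ) + (r.re : ℂ) * Complex.I) = Complex.I * r := by
      apply Complex.ext <;> simp
    rw [e, mul_pow, hr2, Complex.I_sq]
    ring

theorem parabolaFold_spec {p : ℂ} (hp : p.re ^ 2 < p.im) :
    -parabolaFold p ∈ Complex.slitPlane ∧ parabolaUnfold (parabolaFold p) = p := by
  set q := Real.sqrt (p.im - p.re ^ 2) with hq
  have hq0 : 0 < q := Real.sqrt_pos.2 (sub_pos.2 hp)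
  have hq2 : q ^ 2 = p.im - p.re ^ 2 := Real.sq_sqrt (sub_pos.2 hp).le
  set r : ℂ := ⟨q, -p.re⟩ with hr
  have hf : -parabolaFold p = r ^ 2 := by
    have : (p.re : ℂ) + q * Complex.I = Complex.I * r := by
      apply Complex.ext <;> simp [hr]
    rw [parabolaFold, ← hq, this, mul_pow, Complex.I_sq]
    ring
  have hrr : (r ^ 2) ^ (2⁻¹ : ℂ) = r := by
    simpa using Complex.sq_cpow_two_inv (x := r) hq0
  refine ⟨?_, ?_⟩
  · rw [hf, Complex.mem_slitPlane_iff, sq, Complex.mul_re, Complex.mul_im]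
    simp only [hr]
    by_cases hx : p.re = 0
    · left; rw [hx]; simpa using mul_pos hq0 hq0
    · right
      have := mul_ne_zero hq0.ne' hx
      intro h
      exact this (by linarith)
  · have hn : ‖parabolaFold p‖ = p.im := by
      rw [← norm_neg, hf, norm_pow, Complex.sq_norm, Complex.normSq_apply]
      simp only [hr]
      linarith
    rw [parabolaUnfold, hf, hrr, hn]
    apply Complex.ext <;> simp [hr]

/-- `parabolaUnfold` as a homeomorphism from the plane without the nonnegative real axis to the
region above the parabola. -/
noncomputable def parabolaHomeomorph : OpenPartialHomeomorph ℂ ℂ where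
  toFun := parabolaUnfold
  invFun := parabolaFold
  source := {w | -w ∈ Complex.slitPlane}
  target := {p | p.re ^ 2 < p.im}
  map_source' _ hw := (parabolaUnfold_spec hw).1
  map_target' _ hp := (parabolaFold_spec hp).1
  left_inv' _ hw := (parabolaUnfold_spec hw).2
  right_inv' _ hp := (parabolaFold_spec hp).2
  open_source := Complex.isOpen_slitPlane.preimage continuous_neg
  open_target := isOpen_lt (by fun_prop) (by fun_prop)
  continuousOn_toFun := by
    have h1 : ContinuousOn (fun w : ℂ => (-w) ^ (2⁻¹ : ℂ)) {w | -w ∈ Complex.slitPlane} :=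
      ContinuousOn.cpow_const (by fun_prop) fun w hw => hw
    have : parabolaUnfold = fun w : ℂ =>
        ((-((-w) ^ (2⁻¹ : ℂ)).im : ℝ) : ℂ) + (‖w‖ : ℂ) * Complex.I :=
      funext fun w => by apply Complex.ext <;> simp [parabolaUnfold]
    rw [this]
    have h2 := Complex.continuous_im.comp_continuousOn h1
    exact (Complex.continuous_ofReal.comp_continuousOn h2.neg).add (by fun_prop)
  continuousOn_invFun := continuous_parabolaFold.continuousOn

/-- The equation of the line through the points `(a, a ^ 2)` and `(b, b ^ 2)`. -/
def chordLine (a b : ℝ) (p : ℂ) : ℝ :=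
  p.im - (a + b) * p.re + a * b

/-- The point dividing the chord from `(a, a ^ 2)` to `(b, b ^ 2)` in the ratio `t : 1 - t`. -/
def chordPoint (a b t : ℝ) : ℂ :=
  ⟨a + t * (b - a), a ^ 2 + t * (b ^ 2 - a ^ 2)⟩

/-- The image under `parabolaFold` of the chord of the parabola from `(a, a ^ 2)` to `(b, b ^ 2)`.
In the upper half plane this is the image under `z ↦ z ^ 2` of the semicircle over `[a, b]`. -/
noncomputable def foldedChord (a b : ℝ) : Set ℂ :=
  (fun t => parabolaFold (chordPoint a b t)) '' Icc 0 1

theorem chordPoint_above {a b t : ℝ} (hab : a ≠ b) (ht : t ∈ Ioo (0 : ℝ) 1) :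
    (chordPoint a b t).re ^ 2 < (chordPoint a b t).im := by
  have : 0 < t * (1 - t) * (b - a) ^ 2 :=
    mul_pos (mul_pos ht.1 (sub_pos.2 ht.2)) (sq_pos_of_ne_zero (sub_ne_zero.2 hab.symm))
  simp only [chordPoint]
  nlinarith

theorem continuous_chordPoint (a b : ℝ) : Continuous (chordPoint a b) :=
  continuous_mk (by fun_prop) (by fun_prop)

theorem parabolaFold_zero (a b : ℝ) : parabolaFold (chordPoint a b 0) = (a : ℂ) ^ 2 := by
  simp [parabolaFold, chordPoint]

theorem parabolaFold_one (a b : ℝ) : parabolaFold (chordPoint a b 1) = (b : ℂ) ^ 2 := by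
  simp [parabolaFold, chordPoint]

theorem isCompact_foldedChord (a b : ℝ) : IsCompact (foldedChord a b) :=
  isCompact_Icc.image (continuous_parabolaFold.comp (continuous_chordPoint a b))

theorem right_mem_foldedChord (a b : ℝ) : (b : ℂ) ^ 2 ∈ foldedChord a b :=
  ⟨1, by simp, parabolaFold_one a b⟩

theorem foldedChord_self (a : ℝ) : foldedChord a a = {(a : ℂ) ^ 2} := by
  have : ∀ t, parabolaFold (chordPoint a a t) = (a : ℂ) ^ 2 := fun t => by
    simp [parabolaFold, chordPoint]
  simp only [foldedChord, this]
  exact (nonempty_Icc.2 zero_le_one).image_const _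

theorem sq_notMem_source (a : ℝ) : (a : ℂ) ^ 2 ∉ parabolaHomeomorph.source := by
  change ¬ (-(a : ℂ) ^ 2 ∈ Complex.slitPlane)
  rw [show -(a : ℂ) ^ 2 = ((-a ^ 2 : ℝ) : ℂ) by simp, Complex.ofReal_mem_slitPlane]
  simp [sq_nonneg]

theorem mem_foldedChord_of_notMem_source {a b : ℝ} {w : ℂ} (hw : w ∉ parabolaHomeomorph.source)
    (h : w ∈ foldedChord a b) : w = (a : ℂ) ^ 2 ∨ w = (b : ℂ) ^ 2 := by
  obtain ⟨t, ht, rfl⟩ := h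
  rcases eq_or_ne a b with rfl | hab
  · left
    simp [parabolaFold, chordPoint]
  rcases ht.1.eq_or_lt with rfl | h0
  · exact .inl (parabolaFold_zero a b)
  rcases ht.2.eq_or_lt with rfl | h1
  · exact .inr (parabolaFold_one a b)
  · exact absurd (parabolaFold_spec (chordPoint_above hab ⟨h0, h1⟩)).1 hw

theorem re_mem_of_chordLine {a b : ℝ} (hab : a ≤ b) {p : ℂ} (hp : p.re ^ 2 < p.im)
    (h : chordLine a b p = 0) : a < p.re ∧ p.re < b := by
  have h1 : (p.re - a) * (p.re - b) < 0 := by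
    unfold chordLine at h
    nlinarith
  rcases mul_neg_iff.1 h1 with h | h
  · exact ⟨by linarith, by linarith⟩
  · linarith

theorem mem_foldedChord_iff {a b : ℝ} (hab : a ≤ b) {w : ℂ} (hw : w ∈ parabolaHomeomorph.source) :
    w ∈ foldedChord a b ↔ chordLine a b (parabolaUnfold w) = 0 := by
  constructor
  · rintro ⟨t, ht, rfl⟩
    have hw' := hw
    rcases eq_or_ne a b with rfl | hne
    · exact absurd (show _ ∈ foldedChord a a from ⟨t, ht, rfl⟩) (by
        rw [foldedChord_self]
        intro h
        rw [mem_singleton_iff.1 h] at hw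
        exact sq_notMem_source a hw)
    rcases ht.1.eq_or_lt with rfl | h0
    · simp only [parabolaFold_zero] at hw
      exact absurd hw (sq_notMem_source a)
    rcases ht.2.eq_or_lt with rfl | h1
    · simp only [parabolaFold_one] at hw
      exact absurd hw (sq_notMem_source b)
    rw [(parabolaFold_spec (chordPoint_above hne ⟨h0, h1⟩)).2]
    simp only [chordLine, chordPoint]
    ring
  · intro h
    obtain ⟨hp, hpw⟩ := parabolaUnfold_spec hw
    set p := parabolaUnfold w
    obtain ⟨h1, h2⟩ := re_mem_of_chordLine hab hp h
    have hba : 0 < b - a := by linarith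
    refine ⟨(p.re - a) / (b - a), ⟨div_nonneg (by linarith) hba.le, ?_⟩, ?_⟩
    · rw [div_le_one hba]; linarith
    · rw [← hpw]
      have : chordPoint a b ((p.re - a) / (b - a)) = p := by
        apply Complex.ext
        · simp only [chordPoint]
          field_simp
          ring
        · simp only [chordPoint]
          unfold chordLine at h
          field_simp
          linear_combination (-1 : ℝ) * (b - a) * h
      simp only [this]

/-- The intervals `[a, b]` and `[c, d]` overlap without one containing the other. -/
def Interleaved {R : Type*} [LT R] (a b c d : R) : Prop :=
  (a < c ∧ c < b ∧ b < d) ∨ (c < a ∧ a < d ∧ d < b)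

theorem interleaved_of_chordLine {a b c d : ℝ} (hab : a ≤ b) (hcd : c ≤ d)
    (hne : ¬ (a = c ∧ b = d)) {p : ℂ} (hp : p.re ^ 2 < p.im) (h : chordLine a b p = 0)
    (h' : chordLine c d p = 0) : Interleaved a b c d := by
  obtain ⟨h1, h2⟩ := re_mem_of_chordLine hab hp h
  obtain ⟨h3, h4⟩ := re_mem_of_chordLine hcd hp h'
  have e : (p.re - a) * (b - p.re) = (p.re - c) * (d - p.re) := by
    unfold chordLine at h h'
    nlinarith
  rcases lt_trichotomy a c with hac | rfl | hac
  · refine .inl ⟨hac, by linarith, ?_⟩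
    by_contra! hdb
    nlinarith
  · have : b - p.re = d - p.re := mul_left_cancel₀ (sub_pos.2 h1).ne' e
    exact absurd ⟨rfl, by linarith⟩ hne
  · refine .inr ⟨hac, by linarith, ?_⟩
    by_contra! hdb
    nlinarith

theorem Interleaved.sum_ne {a b c d : ℝ} (h : Interleaved a b c d) : a + b ≠ c + d := by
  rcases h with h | h
  · exact (by linarith : a + b < c + d).ne
  · exact (by linarith : c + d < a + b).ne'

theorem eq_of_chordLine {a b c d : ℝ} (hne : a + b ≠ c + d) {p q : ℂ} (h1 : chordLine a b p = 0)
    (h2 : chordLine c d p = 0) (h3 : chordLine a b q = 0) (h4 : chordLine c d q = 0) : p = q := by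
  unfold chordLine at h1 h2 h3 h4
  have hre : p.re = q.re := by
    have : (a + b - (c + d)) * (p.re - q.re) = 0 := by linear_combination h2 - h1 + h3 - h4
    rcases mul_eq_zero.1 this with h | h
    · exact absurd (sub_eq_zero.1 h) hne
    · exact sub_eq_zero.1 h
  refine Complex.ext hre ?_
  rw [hre] at h1
  linarith

theorem Interleaved.exists_mem {a b c d : ℝ} (h : Interleaved a b c d) :
    ∃ w ∈ parabolaHomeomorph.source, w ∈ foldedChord a b ∩ foldedChord c d := by
  have key : ∀ {a b c d : ℝ}, a < c → c < b → b < d →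
      ∃ w ∈ parabolaHomeomorph.source, w ∈ foldedChord a b ∩ foldedChord c d := by
    intro a b c d h1 h2 h3
    have hs : 0 < c + d - (a + b) := by linarith
    set x := (c * d - a * b) / (c + d - (a + b)) with hx
    have hxs : x * (c + d - (a + b)) = c * d - a * b := div_mul_cancel₀ _ hs.ne'
    have hxa : 0 < x - a := by
      have : (x - a) * (c + d - (a + b)) = (c - a) * (d - a) := by linear_combination hxs
      exact (mul_pos_iff_of_pos_right hs).1 (this ▸ mul_pos (by linarith) (by linarith))
    have hxb : 0 < b - x := by
      have : (b - x) * (c + d - (a + b)) = (b - c) * (d - b) := by linear_combination -hxs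
      exact (mul_pos_iff_of_pos_right hs).1 (this ▸ mul_pos (by linarith) (by linarith))
    set p : ℂ := ⟨x, (a + b) * x - a * b⟩ with hp
    have hpt : p.re ^ 2 < p.im := by
      simp only [hp]
      nlinarith [mul_pos hxa hxb]
    obtain ⟨hs1, hs2⟩ := parabolaFold_spec hpt
    refine ⟨parabolaFold p, hs1, ?_, ?_⟩
    · rw [mem_foldedChord_iff (by linarith) hs1, hs2]
      simp only [chordLine, hp]
      ring
    · rw [mem_foldedChord_iff (by linarith) hs1, hs2]
      simp only [chordLine, hp]
      linear_combination -hxs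
  rcases h with ⟨h1, h2, h3⟩ | ⟨h1, h2, h3⟩
  · exact key h1 h2 h3
  · obtain ⟨w, hw, hw'⟩ := key h1 h2 h3
    exact ⟨w, hw, hw'.symm⟩

/-- The affine automorphism of the plane sending two crossing lines to the coordinate axes. -/
noncomputable def crossingLinesHomeomorph {a b c d : ℝ} (h : a + b ≠ c + d) : ℂ ≃ₜ ℂ where
  toFun p := ⟨chordLine c d p, chordLine a b p⟩
  invFun q := ⟨(q.re - q.im - c * d + a * b) / (a + b - (c + d)),
    q.re + (c + d) * ((q.re - q.im - c * d + a * b) / (a + b - (c + d))) - c * d⟩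
  left_inv p := by
    have h' := sub_ne_zero.2 h
    have : (chordLine c d p - chordLine a b p - c * d + a * b) / (a + b - (c + d)) = p.re := by
      rw [div_eq_iff h']
      simp only [chordLine]
      ring
    simp only [this]
    apply Complex.ext
    · rfl
    · simp only [chordLine]
      ring
  right_inv q := by
    have h' := sub_ne_zero.2 h
    apply Complex.ext
    · simp only [chordLine]
      ring
    · simp only [chordLine]
      field_simp
      ring
  continuous_toFun := continuous_mk (by unfold chordLine; fun_prop) (by unfold chordLine; fun_prop)
  continuous_invFun := continuous_mk (by fun_prop) (by fun_prop)

theorem isProperCrossing_foldedChord {a b c d : ℝ} (hab : a ≤ b) (hcd : c ≤ d)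
    (hne : a + b ≠ c + d) {w : ℂ} (hw : w ∈ parabolaHomeomorph.source)
    (h : w ∈ foldedChord a b ∩ foldedChord c d) :
    IsProperCrossing (foldedChord a b) (foldedChord c d) w := by
  refine ⟨parabolaHomeomorph.transHomeomorph (crossingLinesHomeomorph hne), hw, ?_, ?_⟩
  · apply Complex.ext
    · exact (mem_foldedChord_iff hcd hw).1 h.2
    · exact (mem_foldedChord_iff hab hw).1 h.1
  · intro x hx
    exact ⟨mem_foldedChord_iff hab hx, mem_foldedChord_iff hcd hx⟩

/-- Proper crossings are local. -/
theorem IsProperCrossing.congr {A B A' B' C : Set ℂ} {p : ℂ} (h : IsProperCrossing A B p)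
    (hC : IsClosed C) (hp : p ∉ C) (hA : ∀ x ∉ C, x ∈ A ↔ x ∈ A') (hB : ∀ x ∉ C, x ∈ B ↔ x ∈ B') :
    IsProperCrossing A' B' p := by
  obtain ⟨φ, h1, h2, h3⟩ := h
  refine ⟨φ.restrOpen Cᶜ hC.isOpen_compl, ⟨h1, hp⟩, h2, fun x hx => ?_⟩
  rw [← hA x hx.2, ← hB x hx.2]
  exact h3 x hx.1

theorem IsSimpleArc.symm {A : Set ℂ} {p q : ℂ} (h : IsSimpleArc A p q) : IsSimpleArc A q p := by
  obtain ⟨γ, hc, hi, h0, h1, hr⟩ := h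
  refine ⟨γ ∘ unitInterval.symm, hc.comp unitInterval.continuous_symm,
    hi.comp unitInterval.symm_involutive.injective, by simpa, by simpa, ?_⟩
  rw [unitInterval.symm_bijective.surjective.range_comp, hr]

theorem IsSimpleArc.union {A B : Set ℂ} {p q r : ℂ} (hA : IsSimpleArc A p q)
    (hB : IsSimpleArc B q r) (h : A ∩ B ⊆ {q}) : IsSimpleArc (A ∪ B) p r := by
  obtain ⟨α, hαc, hαi, hα0, hα1, rfl⟩ := hA
  obtain ⟨β, hβc, hβi, hβ0, hβ1, rfl⟩ := hB
  let α' : Path p q := ⟨⟨α, hαc⟩, hα0, hα1⟩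
  let β' : Path q r := ⟨⟨β, hβc⟩, hβ0, hβ1⟩
  have key : ∀ s t : unitInterval, α s = β t → s = 1 ∧ t = 0 := by
    intro s t hst
    have h1 : α s = q := h ⟨⟨s, rfl⟩, ⟨t, hst.symm⟩⟩
    exact ⟨hαi (h1.trans hα1.symm), hβi ((hst.symm.trans h1).trans hβ0.symm)⟩
  refine ⟨α'.trans β', (α'.trans β').continuous, ?_, by simp, by simp, Path.trans_range α' β'⟩
  intro s t hst
  rw [Path.trans_apply, Path.trans_apply] at hst
  split_ifs at hst with h1 h2 h2
  · have := congrArg Subtype.val (hαi hst)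
    exact Subtype.ext (by simpa using this)
  · have := congrArg Subtype.val (key _ _ hst).2
    simp only [Icc.coe_zero] at this
    exact absurd h2 (by linarith)
  · have := congrArg Subtype.val (key _ _ hst.symm).2
    simp only [Icc.coe_zero] at this
    exact absurd h1 (by linarith)
  · have := congrArg Subtype.val (hβi hst)
    exact Subtype.ext (by simpa using this)

theorem isSimpleArc_foldedChord {a b : ℝ} (hab : a ^ 2 ≠ b ^ 2) :
    IsSimpleArc (foldedChord a b) ((a : ℂ) ^ 2) ((b : ℂ) ^ 2) := by
  have hne : a ≠ b := fun h => hab (h ▸ rfl)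
  refine ⟨fun t => parabolaFold (chordPoint a b t), (continuous_parabolaFold.comp
    (continuous_chordPoint a b)).comp continuous_subtype_val, ?_, parabolaFold_zero a b,
    parabolaFold_one a b, ?_⟩
  · have hsq : (a : ℂ) ^ 2 ≠ (b : ℂ) ^ 2 := by exact_mod_cast hab
    have hend : ∀ t : unitInterval, parabolaFold (chordPoint a b t) ∈ parabolaHomeomorph.source ∨
        t = 0 ∨ t = 1 := by
      intro t
      by_contra! hcon
      exact hcon.1 (parabolaFold_spec (chordPoint_above hne
        ⟨lt_of_le_of_ne t.2.1 fun e => hcon.2.1 (Subtype.ext e.symm),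
          lt_of_le_of_ne t.2.2 fun e => hcon.2.2 (Subtype.ext e)⟩)).1
    have hint : ∀ t : unitInterval, parabolaFold (chordPoint a b t) ∈ parabolaHomeomorph.source →
        parabolaUnfold (parabolaFold (chordPoint a b t)) = chordPoint a b t := by
      intro t ht
      refine (parabolaFold_spec (chordPoint_above hne
        ⟨lt_of_le_of_ne t.2.1 fun e => ?_, lt_of_le_of_ne t.2.2 fun e => ?_⟩)).2
      · rw [← e, parabolaFold_zero] at ht
        exact sq_notMem_source a ht
      · rw [e, parabolaFold_one] at ht
        exact sq_notMem_source b ht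
    intro s t hst
    simp only at hst
    by_cases hs : parabolaFold (chordPoint a b s) ∈ parabolaHomeomorph.source
    · have h1 := hint s hs
      rw [hst, hint t (hst ▸ hs)] at h1
      have h2 : a + t * (b - a) = a + s * (b - a) := congrArg Complex.re h1
      exact Subtype.ext (mul_right_cancel₀ (sub_ne_zero.2 hne.symm) (add_left_cancel h2)).symm
    · rcases (hend s).resolve_left hs with rfl | rfl <;>
        rcases (hend t).resolve_left (hst ▸ hs) with rfl | rfl
      · rfl
      · exact absurd (by simpa [parabolaFold_zero, parabolaFold_one] using hst) hsq
      · exact absurd (by simpa [parabolaFold_zero, parabolaFold_one] using hst.symm) hsq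
      · rfl
  · ext z
    constructor
    · rintro ⟨t, rfl⟩
      exact ⟨t, t.2, rfl⟩
    · rintro ⟨t, ht, rfl⟩
      exact ⟨⟨t, ht⟩, rfl⟩

/-! ### The chords of the edges -/

/-- Two chords `[a, b]` and `[c, d]`, given by their end positions on the parabola. -/
structure ChordPair where
  (a b c d : ℤ)

/-- The position of the vertex `k` on the parabola. The gaps between the positions leave room for
the points where edges consisting of two chords pass through the fold. -/
def vertexPos (n k : ℕ) : ℕ :=
  if k = 1 then 1 else if k = 2 then n + 10 else n + 3 * k

/-- The chords that make up the edge between the vertices `i < l`. An edge is either a single chord,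
the second one being degenerate, or it consists of two chords that are joined at the fold. -/
def edgeChords (n i l : ℕ) : ChordPair :=
  if i = 2 then
    if l = 3 then ⟨n + 9, n + 10, -(n + 10), -(n + 10)⟩
    else if l = 4 then ⟨-(n + 12), -(n + 10), n + 10, n + 10⟩
    else if l = n then ⟨-(4 * n), n + 10, -(n + 10), -(n + 10)⟩
    else ⟨-(n + 3 * l), l, -(n + 10), -l⟩
  else if i = 1 ∧ l = 2 then ⟨n + 10, n + 13, -(n + 13), 1⟩
  else if i = 3 ∧ l = n then ⟨-(4 * n), n + 11, -(n + 11), -(n + 9)⟩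
  else ⟨-(vertexPos n l : ℤ), vertexPos n i, -(vertexPos n i : ℤ), -(vertexPos n i : ℤ)⟩

/-- The explicit values of `edgeChords`. -/
def EdgeChordsCases (n i l : ℕ) (a b c d : ℤ) : Prop :=
  ((i = 1 ∧ 3 ≤ l) ∧ a = -(n + 3 * l) ∧ b = 1 ∧ c = -1 ∧ d = -1) ∨
  ((3 ≤ i ∧ ¬ (i = 3 ∧ l = n)) ∧ a = -(n + 3 * l) ∧ b = n + 3 * i ∧ c = -(n + 3 * i) ∧
    d = -(n + 3 * i)) ∨
  ((i = 2 ∧ 5 ≤ l ∧ l < n) ∧ a = -(n + 3 * l) ∧ b = l ∧ c = -(n + 10) ∧ d = -l) ∨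
  ((i = 2 ∧ l = n) ∧ a = -(4 * n) ∧ b = n + 10 ∧ c = -(n + 10) ∧ d = -(n + 10)) ∨
  ((i = 3 ∧ l = n) ∧ a = -(4 * n) ∧ b = n + 11 ∧ c = -(n + 11) ∧ d = -(n + 9)) ∨
  ((i = 1 ∧ l = 2) ∧ a = n + 10 ∧ b = n + 13 ∧ c = -(n + 13) ∧ d = 1) ∨
  ((i = 2 ∧ l = 3) ∧ a = n + 9 ∧ b = n + 10 ∧ c = -(n + 10) ∧ d = -(n + 10)) ∨
  ((i = 2 ∧ l = 4) ∧ a = -(n + 12) ∧ b = -(n + 10) ∧ c = n + 10 ∧ d = n + 10)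

theorem edgeChords_cases {n i l : ℕ} (hn : 6 ≤ n) (hi : 1 ≤ i) (hil : i < l) (hl : l ≤ n) :
    EdgeChordsCases n i l (edgeChords n i l).a (edgeChords n i l).b (edgeChords n i l).c
      (edgeChords n i l).d := by
  unfold edgeChords vertexPos
  split_ifs with h1 h2 h3 h4 h5 h6 h7 h8 h9 h10 h11
  all_goals
    simp only
    first
    | exact .inl ⟨by omega, by omega, by omega, by omega, by omega⟩
    | exact .inr (.inl ⟨by omega, by omega, by omega, by omega, by omega⟩)
    | exact .inr (.inr (.inl ⟨by omega, by omega, by omega, by omega, by omega⟩))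
    | exact .inr (.inr (.inr (.inl ⟨by omega, by omega, by omega, by omega, by omega⟩)))
    | exact .inr (.inr (.inr (.inr (.inl ⟨by omega, by omega, by omega, by omega, by omega⟩))))
    | exact .inr (.inr (.inr (.inr (.inr (.inl
        ⟨by omega, by omega, by omega, by omega, by omega⟩)))))
    | exact .inr (.inr (.inr (.inr (.inr (.inr (.inl
        ⟨by omega, by omega, by omega, by omega, by omega⟩))))))
    | exact .inr (.inr (.inr (.inr (.inr (.inr (.inr
        ⟨by omega, by omega, by omega, by omega, by omega⟩))))))

/-- The chords of an edge `il` lead from the vertex `l` through the fold at `b` to the vertex `i`.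
The last chord is degenerate if `b` is already the position of `i`, and the chords do not cross. -/
theorem EdgeChordsCases.self {n i l : ℕ} (hn : 6 ≤ n) (hil : i < l) (hl : l ≤ n)
    {a b c d : ℤ} (h : EdgeChordsCases n i l a b c d) :
    a < b ∧ c ≤ d ∧ a.natAbs = vertexPos n l ∧
    (c.natAbs = b.natAbs ∧ d.natAbs = vertexPos n i ∨
      d.natAbs = b.natAbs ∧ c.natAbs = vertexPos n i) ∧
    a.natAbs ≠ b.natAbs ∧ a.natAbs ≠ vertexPos n i ∧ (b.natAbs = vertexPos n i → c = d) ∧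
    ¬ Interleaved a b c d ∧ ¬ (a = c ∧ b = d) ∧
    ∀ w : ℕ, 1 ≤ w → b.natAbs = vertexPos n w → w = i := by
  unfold EdgeChordsCases at h
  unfold Interleaved vertexPos
  rcases h with h | h | h | h | h | h | h | h
  all_goals
    obtain ⟨h, rfl, rfl, rfl, rfl⟩ := h
    refine ⟨by omega, by omega, by split_ifs <;> omega, ?_, by omega, by split_ifs <;> omega,
      by split_ifs <;> omega, by omega, by omega, ?_⟩
    · split_ifs <;> omega
    · intro w hw
      split_ifs <;> omega


/-- Distinct edges share no chord, and the points where they pass through the fold are distinct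
unless they are a common vertex. -/
theorem EdgeChordsCases.ne {n i l j k : ℕ} (hn : 6 ≤ n) (hil : i < l) (hl : l ≤ n)
    (hjk : j < k) (hk : k ≤ n) (hne : ¬ (i = j ∧ l = k)) {a b c d a' b' c' d' : ℤ}
    (h : EdgeChordsCases n i l a b c d) (h' : EdgeChordsCases n j k a' b' c' d') :
    ¬ (a = a' ∧ b = b') ∧ (c' < d' → ¬ (a = c' ∧ b = d')) ∧ (c < d → ¬ (c = a' ∧ d = b')) ∧
    (c < d → ¬ (c = c' ∧ d = d')) ∧ (b.natAbs = b'.natAbs → i = j ∧ b.natAbs = vertexPos n i) := by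
  unfold EdgeChordsCases at h h'
  unfold vertexPos
  rcases h with h | h | h | h | h | h | h | h <;> obtain ⟨h, rfl, rfl, rfl, rfl⟩ := h <;>
    rcases h' with h' | h' | h' | h' | h' | h' | h' | h' <;>
    obtain ⟨h', rfl, rfl, rfl, rfl⟩ := h' <;>
    (refine ⟨by omega, by omega, by omega, by omega, ?_⟩; split_ifs <;> omega)

/-- At most one chord of an edge interleaves with one of another edge. -/
theorem EdgeChordsCases.unique {n i l j k : ℕ} (hn : 6 ≤ n) (hil : i < l) (hl : l ≤ n)
    (hjk : j < k) {a b c d a' b' c' d' : ℤ}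
    (h : EdgeChordsCases n i l a b c d) (h' : EdgeChordsCases n j k a' b' c' d') :
    (c' < d' → ¬ (Interleaved a b a' b' ∧ Interleaved a b c' d')) ∧
    (c < d → ¬ (Interleaved a b a' b' ∧ Interleaved c d a' b')) ∧
    (c < d → c' < d' → ¬ (Interleaved a b a' b' ∧ Interleaved c d c' d')) ∧
    (c < d → c' < d' → ¬ (Interleaved a b c' d' ∧ Interleaved c d a' b')) ∧
    (c < d → c' < d' → ¬ (Interleaved a b c' d' ∧ Interleaved c d c' d')) ∧
    (c < d → c' < d' → ¬ (Interleaved c d a' b' ∧ Interleaved c d c' d')) := by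
  unfold EdgeChordsCases at h h'
  unfold Interleaved
  rcases h with h | h | h | h | h | h | h | h <;> obtain ⟨h, rfl, rfl, rfl, rfl⟩ := h <;>
    rcases h' with h' | h' | h' | h' | h' | h' | h' | h' <;>
    obtain ⟨h', rfl, rfl, rfl, rfl⟩ := h' <;>
    (refine ⟨?_, ?_, ?_, ?_, ?_, ?_⟩ <;> omega)

/-- Edges with interleaving chords form one of the prescribed pairs. -/
theorem EdgeChordsCases.crossingIndices {n i l j k : ℕ} (hn : 6 ≤ n) (hil : i < l)
    (hl : l ≤ n) (hjk : j < k) (hk : k ≤ n)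
    {a b c d a' b' c' d' : ℤ}
    (h : EdgeChordsCases n i l a b c d) (h' : EdgeChordsCases n j k a' b' c' d')
    (hcr : (Interleaved a b a' b' ∨ Interleaved a b c' d') ∨
      (Interleaved c d a' b' ∨ Interleaved c d c' d')) :
    CrossingIndices n i l j k ∨ CrossingIndices n j k i l := by
  unfold EdgeChordsCases at h h'
  unfold Interleaved at hcr
  rcases h with h | h | h | h | h | h | h | h <;> obtain ⟨h, rfl, rfl, rfl, rfl⟩ := h <;>
    rcases h' with h' | h' | h' | h' | h' | h' | h' | h' <;>
    obtain ⟨h', rfl, rfl, rfl, rfl⟩ := h' <;>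
    rcases hcr with (hcr | hcr) | (hcr | hcr) <;> rcases hcr with hcr | hcr <;>
    first
    | (exfalso; omega)
    | exact .inl (.inl ⟨by omega, by omega, by omega, by omega, by omega, by omega, by omega,
        by omega, by omega⟩)
    | exact .inr (.inl ⟨by omega, by omega, by omega, by omega, by omega, by omega, by omega,
        by omega, by omega⟩)
    | exact .inl (.inr (.inl ⟨by omega, by omega, by omega⟩))
    | exact .inr (.inr (.inl ⟨by omega, by omega, by omega⟩))
    | exact .inl (.inr (.inr (.inl ⟨by omega, by omega, by omega, by omega⟩)))
    | exact .inr (.inr (.inr (.inl ⟨by omega, by omega, by omega, by omega⟩)))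
    | exact .inl (.inr (.inr (.inr (.inl ⟨by omega, by omega, by omega, by omega⟩))))
    | exact .inr (.inr (.inr (.inr (.inl ⟨by omega, by omega, by omega, by omega⟩))))
    | exact .inl (.inr (.inr (.inr (.inr ⟨by omega, by omega, by omega, by omega, by omega⟩))))
    | exact .inr (.inr (.inr (.inr (.inr ⟨by omega, by omega, by omega, by omega, by omega⟩))))

/-- The prescribed pairs of edges have interleaving chords. -/
theorem CrossingIndices.interleaved {n i l j k : ℕ} (hn : 6 ≤ n)
    (hl : l ≤ n) (hjk : j < k) (hk : k ≤ n) {a b c d a' b' c' d' : ℤ}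
    (h : EdgeChordsCases n i l a b c d) (h' : EdgeChordsCases n j k a' b' c' d')
    (hcr : CrossingIndices n i l j k) :
    (Interleaved a b a' b' ∨ Interleaved a b c' d') ∨
      (Interleaved c d a' b' ∨ Interleaved c d c' d') := by
  unfold EdgeChordsCases at h h'
  unfold Interleaved
  rcases h with h | h | h | h | h | h | h | h <;> obtain ⟨h, rfl, rfl, rfl, rfl⟩ := h <;>
    rcases h' with h' | h' | h' | h' | h' | h' | h' | h' <;>
    obtain ⟨h', rfl, rfl, rfl, rfl⟩ := h' <;>
    rcases hcr with hcr | ⟨e1, e2, ⟨e3, hcr | hcr⟩ | hcr⟩ | hcr |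
      ⟨e1, e2, e3, hcr | hcr | hcr | hcr⟩ | hcr <;>
    first
    | (exfalso; omega)
    | exact .inl (.inl (.inl (by omega)))
    | exact .inl (.inl (.inr (by omega)))
    | exact .inl (.inr (.inl (by omega)))
    | exact .inl (.inr (.inr (by omega)))
    | exact .inr (.inl (.inl (by omega)))
    | exact .inr (.inl (.inr (by omega)))
    | exact .inr (.inr (.inl (by omega)))
    | exact .inr (.inr (.inr (by omega)))

/-! ### The drawing with the prescribed crossings -/

/-- The left end of the first (`false`) or second (`true`) chord of a pair. -/
def ChordPair.left (r : ChordPair) (s : Bool) : ℤ := cond s r.c r.a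

/-- The right end of the first (`false`) or second (`true`) chord of a pair. -/
def ChordPair.right (r : ChordPair) (s : Bool) : ℤ := cond s r.d r.b

/-- The first or second chord of a pair, folded. -/
noncomputable def ChordPair.arc (r : ChordPair) (s : Bool) : Set ℂ :=
  foldedChord (r.left s) (r.right s)

/-- The curve representing the edge between the vertices `i < l`. -/
noncomputable def edgeCurve (n i l : ℕ) : Set ℂ :=
  (edgeChords n i l).arc false ∪ (edgeChords n i l).arc true

/-- The point representing the vertex `k`: the fold of its position on the parabola. -/
noncomputable def vertexPoint (n k : ℕ) : ℂ :=
  (((vertexPos n k : ℤ) : ℝ) : ℂ) ^ 2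

theorem sq_intCast_eq_iff {x y : ℤ} :
    (((x : ℝ) : ℂ) ^ 2 = ((y : ℝ) : ℂ) ^ 2) ↔ x.natAbs = y.natAbs := by
  rw [Int.natAbs_eq_iff_sq_eq]
  norm_cast

theorem vertexPoint_eq_iff {n k : ℕ} {x : ℤ} :
    vertexPoint n k = ((x : ℝ) : ℂ) ^ 2 ↔ x.natAbs = vertexPos n k := by
  rw [vertexPoint, sq_intCast_eq_iff, Int.natAbs_natCast, eq_comm]

theorem vertexPos_injective {n j k : ℕ} (hj : 1 ≤ j) (hk : 1 ≤ k)
    (h : vertexPos n j = vertexPos n k) : j = k := by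
  unfold vertexPos at h
  split_ifs at h <;> omega

theorem vertexPoint_injective {n j k : ℕ} (hj : 1 ≤ j) (hk : 1 ≤ k)
    (h : vertexPoint n j = vertexPoint n k) : j = k := by
  refine vertexPos_injective hj hk (n := n) ?_
  rw [vertexPoint, vertexPoint, sq_intCast_eq_iff] at h
  simpa using h

theorem vertexPoint_notMem_source (n k : ℕ) : vertexPoint n k ∉ parabolaHomeomorph.source :=
  sq_notMem_source _

theorem mem_edgeCurve_iff {n i l : ℕ} {p : ℂ} :
    p ∈ edgeCurve n i l ↔ ∃ s, p ∈ (edgeChords n i l).arc s := by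
  simp [edgeCurve]

theorem interleaved_intCast {a b c d : ℤ} :
    Interleaved (a : ℝ) (b : ℝ) (c : ℝ) (d : ℝ) ↔ Interleaved a b c d := by
  unfold Interleaved
  norm_cast

/-- `i < l` are two of the labels `1, …, n`, where `n ≥ 6`. -/
structure EdgeLabels (n i l : ℕ) : Prop where
  six_le : 6 ≤ n
  one_le : 1 ≤ i
  lt : i < l
  le : l ≤ n

section Edge

variable {n i l : ℕ}

theorem EdgeLabels.chordsCases (he : EdgeLabels n i l) : EdgeChordsCases n i l
    (edgeChords n i l).a (edgeChords n i l).b (edgeChords n i l).c (edgeChords n i l).d :=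
  edgeChords_cases he.six_le he.one_le he.lt he.le

theorem left_le_right (he : EdgeLabels n i l) (s : Bool) :
    (edgeChords n i l).left s ≤ (edgeChords n i l).right s := by
  obtain ⟨h1, h2, -⟩ := he.chordsCases.self he.six_le he.lt he.le
  cases s
  · exact h1.le
  · exact h2

/-- A point above the parabola lies only on chords that are not degenerate. -/
theorem left_lt_right_of_mem (he : EdgeLabels n i l) {s : Bool}
    {p : ℂ} (hp : p ∈ parabolaHomeomorph.source) (h : p ∈ (edgeChords n i l).arc s) :
    (edgeChords n i l).left s < (edgeChords n i l).right s := by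
  refine lt_of_le_of_ne (left_le_right he s) fun e => ?_
  rw [ChordPair.arc, e, foldedChord_self, mem_singleton_iff] at h
  exact sq_notMem_source _ (h ▸ hp)

theorem mem_edgeCurve_of_notMem_source (he : EdgeLabels n i l)
    {p : ℂ} (hp : p ∉ parabolaHomeomorph.source) (h : p ∈ edgeCurve n i l) :
    p = vertexPoint n i ∨ p = vertexPoint n l ∨
      p = (((edgeChords n i l).b : ℝ) : ℂ) ^ 2 := by
  obtain ⟨-, -, h1, h2, -⟩ := he.chordsCases.self he.six_le he.lt he.le
  obtain ⟨s, hs⟩ := mem_edgeCurve_iff.1 h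
  have := mem_foldedChord_of_notMem_source hp hs
  cases s
  · rcases this with h | h
    · exact .inr (.inl (h.trans (vertexPoint_eq_iff.2 h1).symm))
    · exact .inr (.inr h)
  · rcases this with rfl | rfl <;> rcases h2 with h2 | h2
    · exact .inr (.inr (sq_intCast_eq_iff.2 h2.1))
    · exact .inl (vertexPoint_eq_iff.2 h2.2).symm
    · exact .inl (vertexPoint_eq_iff.2 h2.2).symm
    · exact .inr (.inr (sq_intCast_eq_iff.2 h2.1))

theorem eq_of_vertexPoint_mem_edgeCurve (he : EdgeLabels n i l)
    {w : ℕ} (hw : 1 ≤ w) (h : vertexPoint n w ∈ edgeCurve n i l) : w = i ∨ w = l := by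
  obtain ⟨-, -, -, -, -, -, -, -, -, h1⟩ := he.chordsCases.self he.six_le he.lt he.le
  rcases mem_edgeCurve_of_notMem_source he (vertexPoint_notMem_source n w) h with
    h | h | h
  · exact .inl (vertexPoint_injective hw he.one_le h)
  · exact .inr (vertexPoint_injective hw (he.one_le.trans he.lt.le) h)
  · exact .inl (h1 w hw (vertexPoint_eq_iff.1 h))

theorem isSimpleArc_edgeCurve (he : EdgeLabels n i l) :
    IsSimpleArc (edgeCurve n i l) (vertexPoint n i) (vertexPoint n l) := by
  obtain ⟨hab, hcd, hal, hbd, hne, hai, hbi, hint, heq, -⟩ :=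
    he.chordsCases.self he.six_le he.lt he.le
  unfold edgeCurve ChordPair.arc ChordPair.left ChordPair.right
  simp only [cond_true, cond_false]
  generalize edgeChords n i l = r at *
  have key : ∀ {x y : ℤ}, x.natAbs ≠ y.natAbs → IsSimpleArc (foldedChord x y)
      (((x : ℝ) : ℂ) ^ 2) (((y : ℝ) : ℂ) ^ 2) := fun h => isSimpleArc_foldedChord fun e =>
    h (sq_intCast_eq_iff.1 (by exact_mod_cast e))
  have h1 := key hne
  rw [← vertexPoint_eq_iff.2 hal] at h1
  by_cases hb : r.b.natAbs = vertexPos n i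
  · -- The second chord is degenerate.
    have hcd' := hbi hb
    have hcb : r.c.natAbs = r.b.natAbs := by
      rcases hbd with h | h
      · exact h.1
      · rw [hcd', h.1]
    rw [← hcd', foldedChord_self, sq_intCast_eq_iff.2 hcb, vertexPoint_eq_iff.2 hb,
      union_eq_self_of_subset_right (singleton_subset_iff.2 (right_mem_foldedChord _ _))]
    rw [vertexPoint_eq_iff.2 hal] at h1 ⊢
    exact h1.symm
  · have h2 : IsSimpleArc (foldedChord r.c r.d) (((r.b : ℝ) : ℂ) ^ 2) (vertexPoint n i) := by
      rcases hbd with ⟨h, h'⟩ | ⟨h, h'⟩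
      · rw [vertexPoint_eq_iff.2 h', ← sq_intCast_eq_iff.2 h]
        exact key (by omega)
      · rw [vertexPoint_eq_iff.2 h', ← sq_intCast_eq_iff.2 h]
        exact (key (by omega)).symm
    refine (h1.union h2 ?_).symm
    rintro w ⟨hw1, hw2⟩
    by_cases hw : w ∈ parabolaHomeomorph.source
    · exact absurd (interleaved_intCast.1 (interleaved_of_chordLine (by exact_mod_cast hab.le)
        (by exact_mod_cast hcd) (by exact_mod_cast heq) (parabolaUnfold_spec hw).1
        ((mem_foldedChord_iff (by exact_mod_cast hab.le) hw).1 hw1)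
        ((mem_foldedChord_iff (by exact_mod_cast hcd) hw).1 hw2))) hint
    · rcases mem_foldedChord_of_notMem_source hw hw1 with rfl | rfl
      · exfalso
        rcases mem_foldedChord_of_notMem_source hw hw2 with h | h <;>
          rw [sq_intCast_eq_iff] at h <;> omega
      · rfl

end Edge

section TwoEdges

variable {n i l j k : ℕ}

/-- The chord `s` of `r` interleaves with the chord `t` of `r'`. -/
def ChordsInterleave (r r' : ChordPair) (s t : Bool) : Prop :=
  Interleaved (r.left s) (r.right s) (r'.left t) (r'.right t)

theorem chordsInterleave_of_mem (he : EdgeLabels n i l) (he' : EdgeLabels n j k)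
    (hne : ¬ (i = j ∧ l = k)) {s t : Bool} {p : ℂ}
    (hp : p ∈ parabolaHomeomorph.source) (h : p ∈ (edgeChords n i l).arc s)
    (h' : p ∈ (edgeChords n j k).arc t) :
    ChordsInterleave (edgeChords n i l) (edgeChords n j k) s t := by
  have hr := left_le_right he s
  have hr' := left_le_right he' t
  have hlt := left_lt_right_of_mem he hp h
  have hlt' := left_lt_right_of_mem he' hp h'
  obtain ⟨h1, h2, h3, h4, -⟩ := he.chordsCases.ne he.six_le he.lt he.le he'.lt he'.le hne
    he'.chordsCases
  refine interleaved_intCast.1 (interleaved_of_chordLine (by exact_mod_cast hr)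
    (by exact_mod_cast hr') ?_ (parabolaUnfold_spec hp).1
    ((mem_foldedChord_iff (by exact_mod_cast hr) hp).1 h)
    ((mem_foldedChord_iff (by exact_mod_cast hr') hp).1 h'))
  norm_cast
  cases s <;> cases t
  · exact h1
  · exact h2 hlt'
  · exact h3 hlt
  · exact h4 hlt

theorem ChordsInterleave.unique (he : EdgeLabels n i l) (he' : EdgeLabels n j k)
    {s t s' t' : Bool}
    (h : ChordsInterleave (edgeChords n i l) (edgeChords n j k) s t)
    (h' : ChordsInterleave (edgeChords n i l) (edgeChords n j k) s' t') : s = s' ∧ t = t' := by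
  obtain ⟨h1, h2, h3, h4, h5, h6⟩ := he.chordsCases.unique he.six_le he.lt he.le he'.lt
    he'.chordsCases
  have lt1 : ∀ {a b c d : ℤ}, Interleaved a b c d → a < b := fun h => by
    unfold Interleaved at h; omega
  have lt2 : ∀ {a b c d : ℤ}, Interleaved a b c d → c < d := fun h => by
    unfold Interleaved at h; omega
  unfold ChordsInterleave at h h'
  cases s <;> cases t <;> cases s' <;> cases t' <;>
    simp only [ChordPair.left, ChordPair.right, cond_true, cond_false] at h h' <;>
    first
    | exact ⟨rfl, rfl⟩
    | exact (h1 (lt2 h) ⟨h', h⟩).elim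
    | exact (h1 (lt2 h') ⟨h, h'⟩).elim
    | exact (h2 (lt1 h) ⟨h', h⟩).elim
    | exact (h2 (lt1 h') ⟨h, h'⟩).elim
    | exact (h3 (lt1 h) (lt2 h) ⟨h', h⟩).elim
    | exact (h3 (lt1 h') (lt2 h') ⟨h, h'⟩).elim
    | exact (h4 (lt1 h) (lt2 h') ⟨h', h⟩).elim
    | exact (h4 (lt1 h') (lt2 h) ⟨h, h'⟩).elim
    | exact (h5 (lt1 h) (lt2 h) ⟨h', h⟩).elim
    | exact (h5 (lt1 h') (lt2 h') ⟨h, h'⟩).elim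
    | exact (h6 (lt1 h) (lt2 h) ⟨h', h⟩).elim
    | exact (h6 (lt1 h') (lt2 h') ⟨h, h'⟩).elim

theorem exists_chordsInterleave_iff (he : EdgeLabels n i l) (he' : EdgeLabels n j k) :
    (∃ s t, ChordsInterleave (edgeChords n i l) (edgeChords n j k) s t) ↔
      CrossingIndices n i l j k ∨ CrossingIndices n j k i l := by
  have h := he.chordsCases
  have h' := he'.chordsCases
  have e : (∃ s t, ChordsInterleave (edgeChords n i l) (edgeChords n j k) s t) ↔ _ :=
    Bool.exists_bool.trans (or_congr Bool.exists_bool Bool.exists_bool)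
  constructor
  · intro hs
    exact h.crossingIndices he.six_le he.lt he.le he'.lt he'.le h' (e.1 hs)
  · rintro (hc | hc)
    · exact e.2 (hc.interleaved he.six_le he.le he'.lt he'.le h h')
    · have := hc.interleaved he.six_le he'.le he.lt he.le h' h
      have sw : ∀ {a b c d : ℤ}, Interleaved a b c d → Interleaved c d a b := fun h => Or.symm h
      rcases this with (h | h) | (h | h)
      · exact ⟨false, false, sw h⟩
      · exact ⟨true, false, sw h⟩
      · exact ⟨false, true, sw h⟩
      · exact ⟨true, true, sw h⟩

/-- Two edges meet outside the fold in crossings of chords, and on the fold in common vertices. -/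
theorem mem_edgeCurve_inter (he : EdgeLabels n i l) (he' : EdgeLabels n j k)
    (hne : ¬ (i = j ∧ l = k)) {p : ℂ} (h : p ∈ edgeCurve n i l)
    (h' : p ∈ edgeCurve n j k) :
    (p ∈ parabolaHomeomorph.source ∧ ∃ s t, p ∈ (edgeChords n i l).arc s ∧
      p ∈ (edgeChords n j k).arc t ∧
      ChordsInterleave (edgeChords n i l) (edgeChords n j k) s t) ∨
    ∃ v, (v = i ∨ v = l) ∧ (v = j ∨ v = k) ∧ p = vertexPoint n v := by
  by_cases hp : p ∈ parabolaHomeomorph.source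
  · left
    obtain ⟨s, hs⟩ := mem_edgeCurve_iff.1 h
    obtain ⟨t, ht⟩ := mem_edgeCurve_iff.1 h'
    exact ⟨hp, s, t, hs, ht, chordsInterleave_of_mem he he' hne hp hs ht⟩
  · right
    rcases mem_edgeCurve_of_notMem_source he hp h with rfl | rfl | hb
    · exact ⟨i, .inl rfl, eq_of_vertexPoint_mem_edgeCurve he' he.one_le h', rfl⟩
    · exact ⟨l, .inr rfl, eq_of_vertexPoint_mem_edgeCurve he' (he.one_le.trans he.lt.le) h', rfl⟩
    · rcases mem_edgeCurve_of_notMem_source he' hp h' with rfl | rfl | hb'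
      · exact ⟨j, eq_of_vertexPoint_mem_edgeCurve he he'.one_le h, .inl rfl, rfl⟩
      · exact ⟨k, eq_of_vertexPoint_mem_edgeCurve he (he'.one_le.trans he'.lt.le) h, .inr rfl, rfl⟩
      · obtain ⟨-, -, -, -, h1⟩ := he.chordsCases.ne he.six_le
          he.lt he.le he'.lt he'.le hne
          he'.chordsCases
        obtain ⟨rfl, h2⟩ := h1 (sq_intCast_eq_iff.1 (hb.symm.trans hb'))
        exact ⟨i, .inl rfl, .inl rfl, hb.trans (vertexPoint_eq_iff.2 h2).symm⟩

theorem CrossingIndices.ne (he : EdgeLabels n i l) (he' : EdgeLabels n j k)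
    (h : CrossingIndices n i l j k) : i ≠ j ∧ i ≠ k ∧ l ≠ j ∧ l ≠ k := by
  obtain ⟨hn, -, hil, -⟩ := he
  obtain ⟨-, -, hjk, -⟩ := he'
  unfold CrossingIndices at h
  omega

theorem ChordsInterleave.ne (he : EdgeLabels n i l) (he' : EdgeLabels n j k) {s t : Bool}
    (h : ChordsInterleave (edgeChords n i l) (edgeChords n j k) s t) :
    i ≠ j ∧ i ≠ k ∧ l ≠ j ∧ l ≠ k := by
  rcases (exists_chordsInterleave_iff he he').1 ⟨s, t, h⟩ with h | h
  · exact h.ne he he'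
  · have := h.ne he' he
    exact ⟨this.1.symm, this.2.2.1.symm, this.2.1.symm, this.2.2.2.symm⟩

theorem subsingleton_edgeCurve_inter (he : EdgeLabels n i l) (he' : EdgeLabels n j k)
    (hne : ¬ (i = j ∧ l = k)) : (edgeCurve n i l ∩ edgeCurve n j k).Subsingleton := by
  rintro p ⟨hp, hp'⟩ q ⟨hq, hq'⟩
  rcases mem_edgeCurve_inter he he' hne hp hp' with ⟨h, s, t, hs, ht, hst⟩ | ⟨v, hv, hv', rfl⟩ <;>
    rcases mem_edgeCurve_inter he he' hne hq hq' with
      ⟨h2, s', t', hs', ht', hst'⟩ | ⟨v', hw, hw', rfl⟩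
  · obtain ⟨rfl, rfl⟩ := ChordsInterleave.unique he he' hst hst'
    have hr : ((edgeChords n i l).left s : ℝ) ≤ (edgeChords n i l).right s := by
      exact_mod_cast left_le_right he s
    have hr' : ((edgeChords n j k).left t : ℝ) ≤ (edgeChords n j k).right t := by
      exact_mod_cast left_le_right he' t
    have := eq_of_chordLine (interleaved_intCast.2 hst).sum_ne ((mem_foldedChord_iff hr h).1 hs)
      ((mem_foldedChord_iff hr' h).1 ht) ((mem_foldedChord_iff hr h2).1 hs')
      ((mem_foldedChord_iff hr' h2).1 ht')
    exact parabolaHomeomorph.injOn h h2 this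
  · have := hst.ne he he'
    omega
  · have := hst'.ne he he'
    omega
  · have h1 := he.lt
    have h2 := he'.lt
    obtain rfl : v = v' := by omega
    rfl

theorem isProperCrossing_edgeCurve (he : EdgeLabels n i l) (he' : EdgeLabels n j k)
    (hne : ¬ (i = j ∧ l = k)) {p : ℂ} (hp : p ∈ parabolaHomeomorph.source) {s t : Bool}
    (hs : p ∈ (edgeChords n i l).arc s) (ht : p ∈ (edgeChords n j k).arc t)
    (hst : ChordsInterleave (edgeChords n i l) (edgeChords n j k) s t) :
    IsProperCrossing (edgeCurve n i l) (edgeCurve n j k) p := by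
  have hr : ((edgeChords n i l).left s : ℝ) ≤ (edgeChords n i l).right s := by
    exact_mod_cast left_le_right he s
  have hr' : ((edgeChords n j k).left t : ℝ) ≤ (edgeChords n j k).right t := by
    exact_mod_cast left_le_right he' t
  have aux : ∀ (m m' : ℕ) (s : Bool), ∀ x ∉ (edgeChords n m m').arc (!s),
      x ∈ (edgeChords n m m').arc s ↔ x ∈ edgeCurve n m m' := by
    intro m m' s x hx
    cases s <;> simp_all [edgeCurve]
  -- Near `p` each edge consists of one chord only.
  refine (isProperCrossing_foldedChord hr hr' (interleaved_intCast.2 hst).sum_ne hp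
    ⟨hs, ht⟩).congr (C := (edgeChords n i l).arc (!s) ∪ (edgeChords n j k).arc (!t))
    ((isCompact_foldedChord _ _).isClosed.union (isCompact_foldedChord _ _).isClosed) ?_
    (fun x hx => aux i l s x fun h => hx (.inl h)) (fun x hx => aux j k t x fun h => hx (.inr h))
  rintro (h | h)
  · have := (ChordsInterleave.unique he he' hst (chordsInterleave_of_mem he he' hne hp h ht)).1
    cases s <;> simp at this
  · have := (ChordsInterleave.unique he he' hst (chordsInterleave_of_mem he he' hne hp hs h)).2
    cases t <;> simp at this

end TwoEdges

/-- The curve representing an edge of the complete graph on `Fin n`, whose vertex `v` has the label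
`v + 1`. -/
noncomputable def modifiedTwistedEdge (n : ℕ) (e : Sym2 (Fin n)) : Set ℂ :=
  edgeCurve n ((e.inf : ℕ) + 1) ((e.sup : ℕ) + 1)

theorem exists_edgeLabels {n : ℕ} (hn : 6 ≤ n) {e : Sym2 (Fin n)} (h : ¬ e.IsDiag) :
    ∃ u v : Fin n, e = s(u, v) ∧ EdgeLabels n (u + 1) (v + 1) ∧
      modifiedTwistedEdge n e = edgeCurve n (u + 1) (v + 1) := by
  have key : ∀ u v : Fin n, u < v → ∃ u' v' : Fin n, s(u, v) = s(u', v') ∧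
      EdgeLabels n (u' + 1) (v' + 1) ∧
      modifiedTwistedEdge n s(u, v) = edgeCurve n (u' + 1) (v' + 1) := by
    intro u v huv
    refine ⟨u, v, rfl, ⟨hn, by omega, by simpa using huv, by omega⟩, ?_⟩
    rw [modifiedTwistedEdge, Sym2.inf_mk, Sym2.sup_mk, inf_eq_left.2 huv.le, sup_eq_right.2 huv.le]
  induction e with
  | _ u v =>
    rcases lt_trichotomy u v with huv | rfl | huv
    · exact key u v huv
    · exact absurd (Sym2.mk_isDiag_iff.2 rfl) h
    · rw [Sym2.eq_swap]
      exact key v u huv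

/-- The drawing with prescribed crossings. -/
noncomputable def modifiedTwistedDrawing {n : ℕ} (hn : 6 ≤ n) : SimpleDrawing (Fin n) where
  pt v := vertexPoint n (v + 1)
  edge := modifiedTwistedEdge n
  pt_injective u v h := by
    have := vertexPoint_injective (by omega) (by omega) h
    exact Fin.ext (by omega)
  edge_arc u v huv := by
    obtain ⟨u', v', h, he, hc⟩ := exists_edgeLabels hn (e := s(u, v))
      (fun h => huv (Sym2.mk_isDiag_iff.1 h))
    rw [hc]
    rcases Sym2.eq_iff.1 h with ⟨rfl, rfl⟩ | ⟨rfl, rfl⟩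
    · exact isSimpleArc_edgeCurve he
    · exact (isSimpleArc_edgeCurve he).symm
  edge_vertex e hd w hw := by
    obtain ⟨u, v, rfl, he, hc⟩ := exists_edgeLabels hn hd
    rw [hc] at hw
    rcases eq_of_vertexPoint_mem_edgeCurve he (by omega) hw with h | h
    · exact Sym2.mem_iff.2 (.inl (Fin.ext (by omega)))
    · exact Sym2.mem_iff.2 (.inr (Fin.ext (by omega)))
  edge_inter e f hd hd' hne := by
    obtain ⟨u, v, rfl, he, hc⟩ := exists_edgeLabels hn hd
    obtain ⟨u', v', rfl, he', hc'⟩ := exists_edgeLabels hn hd'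
    rw [hc, hc']
    refine subsingleton_edgeCurve_inter he he' fun h => hne ?_
    rw [Fin.ext (show (u : ℕ) = u' by omega), Fin.ext (show (v : ℕ) = v' by omega)]
  edge_common e f hd hd' hne p hp := by
    obtain ⟨u, v, rfl, he, hc⟩ := exists_edgeLabels hn hd
    obtain ⟨u', v', rfl, he', hc'⟩ := exists_edgeLabels hn hd'
    rw [hc, hc'] at hp ⊢
    have hne' : ¬ ((u : ℕ) + 1 = u' + 1 ∧ (v : ℕ) + 1 = v' + 1) := fun h => hne (by
      rw [Fin.ext (show (u : ℕ) = u' by omega), Fin.ext (show (v : ℕ) = v' by omega)])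
    rcases mem_edgeCurve_inter he he' hne' hp.1 hp.2 with ⟨h, s, t, hs, ht, hst⟩ | ⟨w, hw, hw', rfl⟩
    · exact .inr (isProperCrossing_edgeCurve he he' hne' h hs ht hst)
    · left
      rcases hw with rfl | rfl
      · exact ⟨u, by simp, Sym2.mem_iff.2 (by simp only [Fin.ext_iff]; omega), rfl⟩
      · exact ⟨v, by simp, Sym2.mem_iff.2 (by simp only [Fin.ext_iff]; omega), rfl⟩

theorem modifiedTwistedDrawing_crosses_iff {n : ℕ} (hn : 6 ≤ n) {e f : Sym2 (Fin n)}
    (hd : ¬ e.IsDiag) (hd' : ¬ f.IsDiag) : (modifiedTwistedDrawing hn).Crosses e f ↔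
      ModifiedTwistedCross n (e.map fun v : Fin n => (v : ℕ) + 1)
        (f.map fun v : Fin n => (v : ℕ) + 1) := by
  obtain ⟨u, v, rfl, he, hc⟩ := exists_edgeLabels hn hd
  obtain ⟨u', v', rfl, he', hc'⟩ := exists_edgeLabels hn hd'
  rw [Sym2.map_mk, Sym2.map_mk, modifiedTwistedCross_iff he.lt he'.lt hn,
    ← exists_chordsInterleave_iff he he']
  constructor
  · rintro ⟨hne, p, hp, hpv⟩
    have hp1 : p ∈ modifiedTwistedEdge n s(u, v) := hp.1
    have hp2 : p ∈ modifiedTwistedEdge n s(u', v') := hp.2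
    rw [hc] at hp1
    rw [hc'] at hp2
    have hne' : ¬ ((u : ℕ) + 1 = u' + 1 ∧ (v : ℕ) + 1 = v' + 1) := fun h => hne (by
      rw [Fin.ext (show (u : ℕ) = u' by omega), Fin.ext (show (v : ℕ) = v' by omega)])
    rcases mem_edgeCurve_inter he he' hne' hp1 hp2 with ⟨-, s, t, -, -, hst⟩ | ⟨w, hw, -, rfl⟩
    · exact ⟨s, t, hst⟩
    · rcases hw with rfl | rfl
      · exact absurd ⟨u, rfl⟩ hpv
      · exact absurd ⟨v, rfl⟩ hpv
  · rintro ⟨s, t, hst⟩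
    refine ⟨fun h => ?_, ?_⟩
    · have := hst.ne he he'
      rcases Sym2.eq_iff.1 h with ⟨rfl, rfl⟩ | ⟨rfl, rfl⟩ <;> omega
    · obtain ⟨p, hp, h1, h2⟩ := (interleaved_intCast.2 hst).exists_mem
      have hp1 : p ∈ modifiedTwistedEdge n s(u, v) := by
        rw [hc]; exact mem_edgeCurve_iff.2 ⟨s, h1⟩
      have hp2 : p ∈ modifiedTwistedEdge n s(u', v') := by
        rw [hc']; exact mem_edgeCurve_iff.2 ⟨t, h2⟩
      refine ⟨p, ⟨hp1, hp2⟩, ?_⟩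
      rintro ⟨w, rfl⟩
      exact vertexPoint_notMem_source _ _ hp

theorem mainTheorem5 (n : ℕ) (hn : 6 ≤ n) :
    (∃ D : SimpleDrawing (Fin n), D.IsModifiedTwisted) ∧
    ∀ D : SimpleDrawing (Fin n), D.IsModifiedTwisted →
      D.CrossingMaximal ∧
      (¬ ∃ v : Fin 4 → Fin n, D.IsEmptyTriangulation v) ∧
      (¬ ∃ v : Fin 4 → Fin n, D.IsHole v) := by
  refine ⟨⟨modifiedTwistedDrawing hn, 1, fun e f he hf =>
    modifiedTwistedDrawing_crosses_iff hn he hf⟩, ?_⟩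
  rintro D ⟨σ, hσ⟩
  have hmax := D.crossingMaximal_of_crosses_iff σ hσ
  have hsep := D.oppositeSeparated_of_crosses_iff hn σ hσ
  exact ⟨hmax, fun ⟨v, hv⟩ => D.not_isEmptyTriangulation hmax hsep v hv,
    fun ⟨v, hv⟩ => D.not_isHole hsep v hv⟩
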